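/- Let $Z$ be a compact oriented smooth Riemannian manifold of dimension $n\ge 1$ with smooth (possibly empty) boundary $\partial Z$, and give $\partial Z$ the induced Riemannian metric and the induced orientation. Write $\Omega^k(\cdot)$ for the space of smooth differential $k$-forms and $\ast$ for the Hodge star (of $Z$, respectively of $\partial Z$). Let $p,q\ge 1$ be integers with $p+q=n+1$, and put $$\mathcal F=\Omega^{n-p}(Z)\times\Omega^{n-q}(Z)\times\Omega^{n-p}(\partial Z)\times\Omega^{n-q}(\partial Z),\qquad \mathcal E=\Omega^{p}(Z)\times\Omega^{q}(Z)\times\Omega^{p-1}(\partial Z)\times\Omega^{q-1}(\partial Z),$$ where $\mathcal E$ is regarded as the (smooth) dual of $\mathcal F$ through $\langle e|f\rangle=\int_{Z+\partial Z}e\wedge f$: wedge products and Hodge stars of quadruples are taken componentwise, and $\int_{Z+\partial Z}$ means that the first two components are integrated over $Z$, the last two over $\partial Z$, and the results added. Let $\mathcal S=\Omega^{n-p}(\partial Z)$ and $\mathcal Y=\Omega^{p-1}(\partial Z)$, with $\langle e_u|f_y\rangle=\int_{\partial Z}e_u\wedge f_y$; let $B:\mathcal S\to\mathcal F$, $B e_u=(0,0,e_u,0)$,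 and $B^\top:\mathcal F\to\mathcal S$, $B^\top(f_1,f_2,f_3,f_4)=f_3$. Let $\mathcal A:\mathcal F\to\mathcal F$ be any linear map (for instance $\mathcal A=\mathrm{diag}(\epsilon,-\mu,0,0)$ with $\epsilon,\mu\in\mathbb R$). Then $$\langle\langle (f^1,f_y^1,e^1,e_u^1),(f^2,f_y^2,e^2,e_u^2)\rangle\rangle=\langle e^1|f^2\rangle+\langle e^2|f^1\rangle+\int_{Z+\partial Z}\bigl(f^1\wedge\ast\mathcal A f^2+f^2\wedge\ast\mathcal A f^1\bigr)+\langle e_u^1|f_y^2\rangle+\langle e_u^2|f_y^1\rangle$$ is a bilinear form on $\mathcal F\times\mathcal Y\times\mathcal E\times\mathcal S$, and the linear subspace $$\mathcal D=\{(f,f_y,e,e_u)\in\mathcal F\times\mathcal Y\times\mathcal E\times\mathcal S:\ -\mathcal A f=\ast e+Be_u,\ f_y=\ast B^\top f\}$$ is a noncanonical Dirac structure, that is, $\mathcal D=\mathcal D^{\perp}$, where $\mathcal D^\perp$ is the orthogonal complement of $\mathcal D$ with respect to this bilinear form. -/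

import Mathlib

open scoped Manifold ContDiff Topology
open Set

noncomputable section

namespace NoncanDirac

section LinearAlgebra

variable {V : Type*} [AddCommGroup V] [Module ℝ V] {k l n : ℕ}

/-- Splitting `n = k + l` indices into the first `k` and the last `l` ones. -/
def splitFin (h : k + l = n) : Fin k ⊕ Fin l ≃ Fin n :=
  finSumFinEquiv.trans (finCongr h)

/-- The wedge product of alternating forms,
`(α ∧ β)(v₁, …, vₙ) = ∑ sign σ α(v_σ(1), …, v_σ(k)) β(v_σ(k+1), …, v_σ(n))`, the sum being over
the `(k, l)`-shuffles `σ`. -/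
def wedge (h : k + l = n) (α : V [⋀^Fin k]→ₗ[ℝ] ℝ) (β : V [⋀^Fin l]→ₗ[ℝ] ℝ) :
    V [⋀^Fin n]→ₗ[ℝ] ℝ :=
  ((LinearMap.mul' ℝ ℝ).compAlternatingMap (α.domCoprod β)).domDomCongr (splitFin h)

/-- Insertion of the vectors `u₁, …, u_k` in the first `k` slots of an alternating form. -/
def insertFirst (h : k + l = n) (μ : V [⋀^Fin n]→ₗ[ℝ] ℝ) (u : Fin k → V) :
    V [⋀^Fin l]→ₗ[ℝ] ℝ where
  toFun w := μ.domDomCongr (splitFin h).symm (Sum.elim u w)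
  map_update_add' := fun w i x y => by
    classical
    have key : ∀ z : V, Sum.elim u (Function.update w i z)
        = Function.update (Sum.elim u w) (Sum.inr i) z := fun z => by
      rw [Sum.update_elim_inr]
    convert (μ.domDomCongr (splitFin h).symm).map_update_add (Sum.elim u w) (Sum.inr i) x y
      using 2 <;> (try congr 1) <;> (convert key _)
  map_update_smul' := fun w i c x => by
    classical
    have key : ∀ z : V, Sum.elim u (Function.update w i z)
        = Function.update (Sum.elim u w) (Sum.inr i) z := fun z => by
      rw [Sum.update_elim_inr]
    convert (μ.domDomCongr (splitFin h).symm).map_update_smul (Sum.elim u w) (Sum.inr i) c x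
      using 2 <;> (try congr 1) <;> (convert key _)
  map_eq_zero_of_eq' := fun w i j hw hij =>
    (μ.domDomCongr (splitFin h).symm).map_eq_zero_of_eq (Sum.elim u w)
      (i := Sum.inr i) (j := Sum.inr j) (by simpa using hw) (by simpa using hij)

/-- The frame `w` is a positively oriented basis. -/
def IsPosFrame (o : Orientation ℝ V (Fin n)) (w : Fin n → V) : Prop :=
  ∃ b : Module.Basis (Fin n) ℝ V, ⇑b = w ∧ b.orientation = o

open Classical in
/-- The sign of a frame: `1` if it is positively oriented, `-1` if it is negatively oriented. -/
def frameSign (o : Orientation ℝ V (Fin n)) (w : Fin n → V) : ℝ :=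
  if IsPosFrame o w then 1 else -1

/-- The Hodge star of a `k`-form, computed in an orthonormal basis `b`:
`⋆θ (w) = (1 / k!) ∑ θ(b_{i₁}, …, b_{i_k}) vol(b_{i₁}, …, b_{i_k}, w)`, where `vol` is the volume
form of the orientation. The result does not depend on the orthonormal basis. -/
def hodgeInBasis (h : k + l = n) (b : Module.Basis (Fin n) ℝ V) (o : Orientation ℝ V (Fin n)) :
    (V [⋀^Fin k]→ₗ[ℝ] ℝ) →ₗ[ℝ] V [⋀^Fin l]→ₗ[ℝ] ℝ where
  toFun θ := (k.factorial : ℝ)⁻¹ • ∑ i : Fin k → Fin n,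
    θ (fun a => b (i a)) • insertFirst h (frameSign o b • b.det) (fun a => b (i a))
  map_add' θ η := by
    simp only [AlternatingMap.add_apply, add_smul, Finset.sum_add_distrib, smul_add]
  map_smul' c θ := by
    simp only [AlternatingMap.smul_apply, smul_eq_mul, mul_smul, ← Finset.smul_sum,
      RingHom.id_apply]
    rw [smul_comm]

theorem exists_orthonormal_basis [FiniteDimensional ℝ V] (hn : Module.finrank ℝ V = n)
    (c : InnerProductSpace.Core ℝ V) :
    ∃ b : Module.Basis (Fin n) ℝ V, ∀ i j, c.inner (b i) (b j) = if i = j then 1 else 0 := by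
  let _ : NormedAddCommGroup V := c.toNormedAddCommGroup
  let _ : InnerProductSpace ℝ V := InnerProductSpace.ofCore c.toCore
  let b := (stdOrthonormalBasis ℝ V).reindex (finCongr hn)
  refine ⟨b.toBasis, fun i j => ?_⟩
  have := orthonormal_iff_ite.1 b.orthonormal i j
  simpa using this

end LinearAlgebra

section Forms

variable {n : ℕ} {H : Type*} [TopologicalSpace H]
  (I : ModelWithCorners ℝ (EuclideanSpace ℝ (Fin n)) H)
  (M : Type*) [TopologicalSpace M] [ChartedSpace H M]

/-- A (not necessarily continuous) field of alternating `k`-forms on the tangent spaces. -/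
def RawForm (k : ℕ) : Type _ := (x : M) → TangentSpace I x [⋀^Fin k]→ₗ[ℝ] ℝ

instance (k : ℕ) : AddCommGroup (RawForm I M k) :=
  inferInstanceAs (AddCommGroup ((x : M) → TangentSpace I x [⋀^Fin k]→ₗ[ℝ] ℝ))

instance (k : ℕ) : Module ℝ (RawForm I M k) :=
  inferInstanceAs (Module ℝ ((x : M) → TangentSpace I x [⋀^Fin k]→ₗ[ℝ] ℝ))

variable {I M} in
theorem exists_orthonormal_tangent_basis
    (g : Bundle.RiemannianMetric (fun x : M => TangentSpace I x)) (x : M) :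
    ∃ b : Module.Basis (Fin n) ℝ (TangentSpace I x),
      ∀ i j, g.inner x (b i) (b j) = if i = j then 1 else 0 := by
  have : FiniteDimensional ℝ (TangentSpace I x) :=
    inferInstanceAs (FiniteDimensional ℝ (EuclideanSpace ℝ (Fin n)))
  have hn : Module.finrank ℝ (TangentSpace I x) = n :=
    (finrank_euclideanSpace_fin : Module.finrank ℝ (EuclideanSpace ℝ (Fin n)) = n)
  exact exists_orthonormal_basis hn (g.toCore x)

variable {I M} in
/-- A basis of the tangent space at `x` which is orthonormal for the metric `g`. -/
def orthonormalTangentBasis (g : Bundle.RiemannianMetric (fun x : M => TangentSpace I x)) (x : M) :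
    Module.Basis (Fin n) ℝ (TangentSpace I x) :=
  (exists_orthonormal_tangent_basis g x).choose

variable {M} [IsManifold I ∞ M]

/-- The coordinate vector fields of the preferred chart at `x₀`, evaluated at `x`. -/
def coordFrame (x₀ x : M) (i : Fin n) : TangentSpace I x :=
  letI e : EuclideanSpace ℝ (Fin n) := EuclideanSpace.single i 1
  (tangentCoordChange I x₀ x x e : EuclideanSpace ℝ (Fin n))

variable (M)

/-- The space `Ωᵏ(M)` of smooth differential `k`-forms: those whose coefficients
`θ(∂_{i₁}, …, ∂_{i_k})` in each chart are smooth functions (up to the boundary). -/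
def Form (k : ℕ) : Submodule ℝ (RawForm I M k) where
  carrier := {θ | ∀ (x₀ : M) (i : Fin k → Fin n),
    ContMDiffOn I 𝓘(ℝ, ℝ) ∞ (fun x => θ x (fun a => coordFrame I x₀ x (i a)))
      (chartAt H x₀).source}
  add_mem' := fun h₁ h₂ x₀ i => (h₁ x₀ i).add (h₂ x₀ i)
  zero_mem' := fun _ _ => contMDiffOn_const
  smul_mem' := fun _ _ h₁ x₀ i => contMDiffOn_const.mul (h₁ x₀ i)

/-- An orientation of a manifold: a choice of an orientation of each tangent space which is
continuous, that is, each coordinate frame is near each point of its domain either positive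
everywhere or negative everywhere. -/
structure ManifoldOrientation where
  /-- The orientation of each tangent space. -/
  toFun : (x : M) → Orientation ℝ (TangentSpace I x) (Fin n)
  continuous' : ∀ x₀ : M, ∀ x ∈ (chartAt H x₀).source,
    (∀ᶠ y in 𝓝 x, IsPosFrame (toFun y) (coordFrame I x₀ y)) ∨
    (∀ᶠ y in 𝓝 x, ¬ IsPosFrame (toFun y) (coordFrame I x₀ y))

variable {M} {I}

/-- The pointwise wedge product. -/
def RawForm.wedge {k l r : ℕ} (h : k + l = r) (θ : RawForm I M k) (η : RawForm I M l) :
    RawForm I M r := fun x => NoncanDirac.wedge h (θ x) (η x)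

/-- The Hodge star operator of a metric `g` and an orientation `o`. -/
def hodgeStar {k l : ℕ} (h : k + l = n)
    (g : Bundle.RiemannianMetric (fun x : M => TangentSpace I x))
    (o : (x : M) → Orientation ℝ (TangentSpace I x) (Fin n)) :
    RawForm I M k →ₗ[ℝ] RawForm I M l where
  toFun θ := fun x => hodgeInBasis h (orthonormalTangentBasis g x) (o x) (θ x)
  map_add' θ η := funext fun x =>
    (hodgeInBasis h (orthonormalTangentBasis g x) (o x)).map_add (θ x) (η x)
  map_smul' c θ := funext fun x =>
    (hodgeInBasis h (orthonormalTangentBasis g x) (o x)).map_smul c (θ x)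

variable (I M)

/-- A smooth partition of unity subordinate to the domains of the preferred charts. -/
def chartPartition [T2Space M] [SigmaCompactSpace M] : SmoothPartitionOfUnity M I M univ :=
  (SmoothPartitionOfUnity.exists_isSubordinate_chartAt_source I M).choose

variable {I M}

/-- The integral of a top-degree form over an oriented manifold: the sum over the charts of a
subordinate partition of unity `ρ` of the integrals of the coefficients `ρ θ(∂₁, …, ∂ₙ)`, with the
opposite sign where the chart reverses the orientation. -/
def formIntegral [T2Space M] [SigmaCompactSpace M]
    (o : (x : M) → Orientation ℝ (TangentSpace I x) (Fin n)) (θ : RawForm I M n) : ℝ :=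
  ∑ᶠ x₀ : M, ∫ u in (extChartAt I x₀).target,
    letI x : M := (extChartAt I x₀).symm u
    chartPartition I M x₀ x * frameSign (o x) (coordFrame I x₀ x) * θ x (coordFrame I x₀ x)

end Forms

section Boundary

variable {m : ℕ}

/-- The inclusion `ℝᵐ → ℝᵐ⁺¹`, `v ↦ (0, v)`. -/
def consZero (m : ℕ) : EuclideanSpace ℝ (Fin m) →L[ℝ] EuclideanSpace ℝ (Fin (m + 1)) :=
  LinearMap.toContinuousLinearMap
    { toFun := fun v => WithLp.toLp 2 (Fin.cons (0 : ℝ) (fun i => v i))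
      map_add' := fun v w => by
        ext i; refine Fin.cases ?_ (fun j => ?_) i <;> simp
      map_smul' := fun c v => by
        ext i; refine Fin.cases ?_ (fun j => ?_) i <;> simp }

/-- The projection `ℝᵐ⁺¹ → ℝᵐ` forgetting the coordinate of index `0`. -/
def dropZero (m : ℕ) : EuclideanSpace ℝ (Fin (m + 1)) →L[ℝ] EuclideanSpace ℝ (Fin m) :=
  LinearMap.toContinuousLinearMap
    { toFun := fun v => WithLp.toLp 2 (fun i => v i.succ)
      map_add' := fun v w => by ext i; simp
      map_smul' := fun c v => by ext i; simp }

@[simp] theorem consZero_zero (v : EuclideanSpace ℝ (Fin m)) : consZero m v 0 = 0 := rfl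

@[simp] theorem consZero_succ (v : EuclideanSpace ℝ (Fin m)) (i : Fin m) :
    consZero m v i.succ = v i := rfl

@[simp] theorem dropZero_apply (v : EuclideanSpace ℝ (Fin (m + 1))) (i : Fin m) :
    dropZero m v i = v i.succ := rfl

@[simp] theorem dropZero_consZero (v : EuclideanSpace ℝ (Fin m)) :
    dropZero m (consZero m v) = v := by ext i; simp

theorem consZero_dropZero {v : EuclideanSpace ℝ (Fin (m + 1))} (hv : v 0 = 0) :
    consZero m (dropZero m v) = v := by
  ext i; refine Fin.cases ?_ (fun j => ?_) i <;> simp [hv]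

theorem consZero_injective : Function.Injective (consZero m) :=
  Function.LeftInverse.injective dropZero_consZero

/-- The inclusion of `ℝᵐ` into the half-space as its boundary hyperplane. -/
def toHalfSpace (m : ℕ) (v : EuclideanSpace ℝ (Fin m)) : EuclideanHalfSpace (m + 1) :=
  ⟨consZero m v, le_rfl⟩

theorem continuous_toHalfSpace : Continuous (toHalfSpace m) :=
  (consZero m).continuous.subtype_mk _

theorem toHalfSpace_dropZero {z : EuclideanHalfSpace (m + 1)} (hz : z.val 0 = 0) :
    toHalfSpace m (dropZero m z.val) = z :=
  Subtype.ext (consZero_dropZero hz)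

variable {Z : Type*} [TopologicalSpace Z] [ChartedSpace (EuclideanHalfSpace (m + 1)) Z]
  [IsManifold (𝓡∂ (m + 1)) ∞ Z]

/-- A point in the domain of a chart lies on the boundary iff its coordinate of index `0`
vanishes. -/
theorem mem_boundary_iff {e : OpenPartialHomeomorph Z (EuclideanHalfSpace (m + 1))}
    (he : e ∈ atlas (EuclideanHalfSpace (m + 1)) Z) {z : Z} (hz : z ∈ e.source) :
    z ∈ (𝓡∂ (m + 1)).boundary Z ↔ (e z).val 0 = 0 := by
  have h1 : (𝓡∂ (m + 1)).IsInteriorPoint z ↔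
      e.extend (𝓡∂ (m + 1)) z ∈ interior (range (𝓡∂ (m + 1))) := by
    rw [ModelWithCorners.isInteriorPoint_iff_of_mem_atlas (n := ∞) (by simp) he hz]
    constructor
    · exact fun h => OpenPartialHomeomorph.interior_extend_target_subset_interior_range _ h
    · exact fun h => e.mem_interior_extend_target (by simp [hz]) h
  have h2 : z ∈ (𝓡∂ (m + 1)).boundary Z ↔ ¬ (𝓡∂ (m + 1)).IsInteriorPoint z :=
    (𝓡∂ (m + 1)).isBoundaryPoint_iff_not_isInteriorPoint z
  rw [h2, h1, interior_range_modelWithCornersEuclideanHalfSpace]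
  have h3 : e.extend (𝓡∂ (m + 1)) z = (e z).val := rfl
  have h4 := (e z).property
  rw [h3, mem_ofPred_eq, not_lt]
  exact ⟨fun h => le_antisymm h h4, fun h => h.le⟩

theorem symm_toHalfSpace_mem_boundary
    {e : OpenPartialHomeomorph Z (EuclideanHalfSpace (m + 1))}
    (he : e ∈ atlas (EuclideanHalfSpace (m + 1)) Z) {v : EuclideanSpace ℝ (Fin m)}
    (hv : toHalfSpace m v ∈ e.target) :
    e.symm (toHalfSpace m v) ∈ (𝓡∂ (m + 1)).boundary Z := by
  rw [mem_boundary_iff he (e.map_target hv), e.right_inv hv]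
  rfl

open Classical in
/-- The chart of the boundary obtained by restricting a chart of the manifold and forgetting
the coordinate of index `0`, which vanishes on the boundary. (The point `y` only serves as the
value of the inverse outside the target.) -/
def boundaryChart (e : OpenPartialHomeomorph Z (EuclideanHalfSpace (m + 1)))
    (he : e ∈ atlas (EuclideanHalfSpace (m + 1)) Z) (y : (𝓡∂ (m + 1)).boundary Z) :
    OpenPartialHomeomorph ((𝓡∂ (m + 1)).boundary Z) (EuclideanSpace ℝ (Fin m)) where
  toFun z := dropZero m (e z.1).val
  invFun v := if hv : toHalfSpace m v ∈ e.target then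
    ⟨e.symm (toHalfSpace m v), symm_toHalfSpace_mem_boundary he hv⟩ else y
  source := {z | z.1 ∈ e.source}
  target := {v | toHalfSpace m v ∈ e.target}
  map_source' := fun z hz => by
    rw [mem_ofPred_eq, toHalfSpace_dropZero ((mem_boundary_iff he hz).1 z.2)]
    exact e.map_source hz
  map_target' := fun v hv => by
    rw [mem_ofPred_eq] at hv
    rw [dif_pos hv]
    exact e.map_target hv
  left_inv' := fun z hz => by
    have h := toHalfSpace_dropZero ((mem_boundary_iff he hz).1 z.2)
    have h' : toHalfSpace m (dropZero m (e z.1).val) ∈ e.target := by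
      rw [h]; exact e.map_source hz
    rw [dif_pos h']
    apply Subtype.ext
    change e.symm (toHalfSpace m (dropZero m (e z.1).val)) = z.1
    rw [h]
    exact e.left_inv hz
  right_inv' := fun v hv => by
    rw [mem_ofPred_eq] at hv
    rw [dif_pos hv]
    change dropZero m (e (e.symm (toHalfSpace m v))).val = v
    rw [e.right_inv hv]
    exact dropZero_consZero v
  open_source := e.open_source.preimage continuous_subtype_val
  open_target := e.open_target.preimage continuous_toHalfSpace
  continuousOn_toFun := by
    refine (dropZero m).continuous.comp_continuousOn ?_
    refine continuous_subtype_val.comp_continuousOn ?_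
    exact e.continuousOn.comp continuous_subtype_val.continuousOn (fun z hz => hz)
  continuousOn_invFun := by
    rw [Topology.IsInducing.subtypeVal.continuousOn_iff]
    have h : ContinuousOn (fun v => e.symm (toHalfSpace m v))
        {v | toHalfSpace m v ∈ e.target} :=
      e.continuousOn_symm.comp continuous_toHalfSpace.continuousOn (fun v hv => hv)
    refine h.congr (fun v hv => ?_)
    rw [mem_ofPred_eq] at hv
    simp [hv]

theorem boundaryChart_apply {e : OpenPartialHomeomorph Z (EuclideanHalfSpace (m + 1))}
    {he : e ∈ atlas (EuclideanHalfSpace (m + 1)) Z} {y z : (𝓡∂ (m + 1)).boundary Z} :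
    boundaryChart e he y z = dropZero m (e z.1).val := rfl

open Classical in
theorem boundaryChart_symm_apply {e : OpenPartialHomeomorph Z (EuclideanHalfSpace (m + 1))}
    {he : e ∈ atlas (EuclideanHalfSpace (m + 1)) Z} {y : (𝓡∂ (m + 1)).boundary Z}
    {v : EuclideanSpace ℝ (Fin m)} (hv : toHalfSpace m v ∈ e.target) :
    ((boundaryChart e he y).symm v).1 = e.symm (toHalfSpace m v) := by
  change ((dite _ _ _ : (𝓡∂ (m + 1)).boundary Z)).1 = _
  rw [dif_pos hv]

/-- The boundary of an `(m + 1)`-dimensional smooth manifold with boundary, with the charts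
restricted from the ambient manifold. -/
instance boundaryChartedSpace :
    ChartedSpace (EuclideanSpace ℝ (Fin m)) ((𝓡∂ (m + 1)).boundary Z) where
  atlas := range fun y : (𝓡∂ (m + 1)).boundary Z =>
    boundaryChart (chartAt (EuclideanHalfSpace (m + 1)) y.1) (chart_mem_atlas _ y.1) y
  chartAt y := boundaryChart (chartAt (EuclideanHalfSpace (m + 1)) y.1) (chart_mem_atlas _ y.1) y
  mem_chart_source y := mem_chart_source (EuclideanHalfSpace (m + 1)) y.1
  chart_mem_atlas y := mem_range_self y

/-- The boundary is a smooth manifold. -/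
instance boundaryIsManifold : IsManifold (𝓡 m) ∞ ((𝓡∂ (m + 1)).boundary Z) := by
  apply isManifold_of_contDiffOn
  rintro _ _ ⟨y, rfl⟩ ⟨y', rfl⟩
  set e := chartAt (EuclideanHalfSpace (m + 1)) y.1 with he
  set e' := chartAt (EuclideanHalfSpace (m + 1)) y'.1 with he'
  have hc : ContDiffOn ℝ ∞ ((𝓡∂ (m + 1)).extendCoordChange e e')
      ((𝓡∂ (m + 1)).extendCoordChange e e').source :=
    ModelWithCorners.contDiffOn_extendCoordChange
      (IsManifold.subset_maximalAtlas (chart_mem_atlas _ y.1))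
      (IsManifold.subset_maximalAtlas (chart_mem_atlas _ y'.1))
  have hsub : ∀ v ∈ (𝓡 m).symm ⁻¹' ((boundaryChart e (chart_mem_atlas _ y.1) y).symm ≫ₕ
      boundaryChart e' (chart_mem_atlas _ y'.1) y').source ∩ range (𝓡 m),
      toHalfSpace m v ∈ e.target ∧ e.symm (toHalfSpace m v) ∈ e'.source := by
    rintro v ⟨hv, -⟩
    simp only [mem_preimage, OpenPartialHomeomorph.trans_source, mem_inter_iff] at hv
    have h1 : toHalfSpace m v ∈ e.target := hv.1
    have h2 : ((boundaryChart e (chart_mem_atlas _ y.1) y).symm v).1 ∈ e'.source := hv.2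
    rw [boundaryChart_symm_apply h1] at h2
    exact ⟨h1, h2⟩
  have hsymm : ∀ v : EuclideanSpace ℝ (Fin m),
      (𝓡∂ (m + 1)).symm (consZero m v) = toHalfSpace m v := fun v =>
    (𝓡∂ (m + 1)).left_inv (toHalfSpace m v)
  have hcomp : ContDiffOn ℝ ∞ (fun v => dropZero m
      ((𝓡∂ (m + 1)).extendCoordChange e e' (consZero m v)))
      ((𝓡 m).symm ⁻¹' ((boundaryChart e (chart_mem_atlas _ y.1) y).symm ≫ₕ
      boundaryChart e' (chart_mem_atlas _ y'.1) y').source ∩ range (𝓡 m)) := by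
    refine (dropZero m).contDiff.comp_contDiffOn (hc.comp (consZero m).contDiff.contDiffOn ?_)
    intro v hv
    obtain ⟨h1, h2⟩ := hsub v hv
    rw [ModelWithCorners.extendCoordChange_source]
    refine ⟨toHalfSpace m v, ?_, rfl⟩
    simp [h1, h2]
  refine hcomp.congr (fun v hv => ?_)
  obtain ⟨h1, h2⟩ := hsub v hv
  change dropZero m (e' ((boundaryChart e (chart_mem_atlas _ y.1) y).symm v).1).val = _
  rw [boundaryChart_symm_apply h1]
  change _ = dropZero m (e' (e.symm ((𝓡∂ (m + 1)).symm (consZero m v)))).val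
  rw [hsymm]

instance boundaryCompactSpace [CompactSpace Z] : CompactSpace ((𝓡∂ (m + 1)).boundary Z) :=
  isCompact_iff_compactSpace.1
    ((𝓡∂ (m + 1)).isClosed_boundary (M := Z) (n := ∞) (by simp)).isCompact

/-- In the preferred charts, the derivative of the inclusion of the boundary is `v ↦ (0, v)`. -/
theorem hasMFDerivAt_boundary_val (y : (𝓡∂ (m + 1)).boundary Z) :
    HasMFDerivAt (𝓡 m) (𝓡∂ (m + 1)) (Subtype.val : (𝓡∂ (m + 1)).boundary Z → Z) y
      (consZero m) := by
  refine ⟨continuous_subtype_val.continuousAt, ?_⟩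
  have key : ∀ v ∈ (extChartAt (𝓡 m) y).target,
      writtenInExtChartAt (𝓡 m) (𝓡∂ (m + 1)) y Subtype.val v = consZero m v := by
    intro v hv
    have hv' : toHalfSpace m v ∈ (chartAt (EuclideanHalfSpace (m + 1)) y.1).target := by
      simpa [extChartAt] using! hv
    change ((chartAt (EuclideanHalfSpace (m + 1)) y.1)
      ((boundaryChart (chartAt (EuclideanHalfSpace (m + 1)) y.1)
        (chart_mem_atlas _ y.1) y).symm v).1).val = _
    rw [boundaryChart_symm_apply hv', OpenPartialHomeomorph.right_inv _ hv']
    rfl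
  have h : HasFDerivAt (writtenInExtChartAt (𝓡 m) (𝓡∂ (m + 1)) y Subtype.val) (consZero m)
      ((extChartAt (𝓡 m) y) y) :=
    (consZero m).hasFDerivAt.congr_of_eventuallyEq
      (Filter.eventually_of_mem (extChartAt_target_mem_nhds y) key)
  exact h.hasFDerivWithinAt

theorem mfderiv_boundary_val (y : (𝓡∂ (m + 1)).boundary Z) :
    mfderiv (𝓡 m) (𝓡∂ (m + 1)) (Subtype.val : (𝓡∂ (m + 1)).boundary Z → Z) y = consZero m :=
  (hasMFDerivAt_boundary_val y).mfderiv

end Boundary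

section BoundaryStructure

variable {m : ℕ} {Z : Type*} [TopologicalSpace Z] [ChartedSpace (EuclideanHalfSpace (m + 1)) Z]
  [IsManifold (𝓡∂ (m + 1)) ∞ Z]

/-- The differential at `y` of the inclusion of the boundary. -/
def boundaryDiff (y : (𝓡∂ (m + 1)).boundary Z) :
    TangentSpace (𝓡 m) y →L[ℝ] TangentSpace (𝓡∂ (m + 1)) y.1 :=
  mfderiv (𝓡 m) (𝓡∂ (m + 1)) (Subtype.val : (𝓡∂ (m + 1)).boundary Z → Z) y

theorem boundaryDiff_injective (y : (𝓡∂ (m + 1)).boundary Z) :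
    Function.Injective (boundaryDiff y) := by
  have h : boundaryDiff y = consZero m := mfderiv_boundary_val y
  rw [h]
  exact consZero_injective

/-- The metric induced on the boundary. -/
def boundaryMetric (g : Bundle.RiemannianMetric (fun x : Z => TangentSpace (𝓡∂ (m + 1)) x)) :
    Bundle.RiemannianMetric
      (fun y : (𝓡∂ (m + 1)).boundary Z => TangentSpace (𝓡 m) y) where
  inner y := ContinuousLinearMap.precomp ℝ (boundaryDiff y) ∘L g.inner y.1 ∘L boundaryDiff y
  symm y v w := g.symm y.1 _ _
  pos y v hv := g.pos y.1 _ (fun h => hv (boundaryDiff_injective y (h.trans (map_zero _).symm)))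
  continuousAt y := by
    have h0 : boundaryDiff y 0 = 0 := map_zero _
    have h1 := g.continuousAt y.1
    rw [← h0] at h1
    exact ContinuousAt.comp (g := fun v => g.inner y.1 v v) h1 (boundaryDiff y).continuous.continuousAt
  isVonNBounded y := by
    let P : TangentSpace (𝓡∂ (m + 1)) y.1 →L[ℝ] TangentSpace (𝓡 m) y := dropZero m
    have hd : boundaryDiff y = consZero m := mfderiv_boundary_val y
    have hP : ∀ v, P (boundaryDiff y v) = v := fun v => by
      rw [hd]; exact dropZero_consZero _
    refine ((g.isVonNBounded y.1).image P).subset (fun v hv => ?_)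
    exact ⟨boundaryDiff y v, hv, hP v⟩

/-- The vector pointing out of the manifold at a boundary point, in the preferred chart with
values in the half-space `{x | 0 ≤ x 0}`. -/
def outwardVector (x : Z) : TangentSpace (𝓡∂ (m + 1)) x :=
  (-EuclideanSpace.single 0 1 : EuclideanSpace ℝ (Fin (m + 1)))

/-- The standard basis of the tangent space of the boundary, in the preferred chart. -/
def boundaryBasis (y : (𝓡∂ (m + 1)).boundary Z) :
    Module.Basis (Fin m) ℝ (TangentSpace (𝓡 m) y) :=
  ((EuclideanSpace.basisFun (Fin m) ℝ).toBasis : Module.Basis (Fin m) ℝ (EuclideanSpace ℝ (Fin m)))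

open Classical in
/-- The orientation induced on the boundary, with the convention "outward vector first":
`(v₁, …, v_m)` is positive iff `(ν, v₁, …, v_m)` is positive, `ν` pointing outward. -/
def boundaryOrientation (o : (x : Z) → Orientation ℝ (TangentSpace (𝓡∂ (m + 1)) x) (Fin (m + 1)))
    (y : (𝓡∂ (m + 1)).boundary Z) : Orientation ℝ (TangentSpace (𝓡 m) y) (Fin m) :=
  if IsPosFrame (o y.1)
      (Fin.cons (outwardVector y.1) (fun i => boundaryDiff y (boundaryBasis y i)))
    then (boundaryBasis y).orientation else -(boundaryBasis y).orientation

end BoundaryStructure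

section Dirac

/-- The degrees occurring in an `n`-dimensional port-Hamiltonian system, `n = m + 1`:
`p + q = n + 1` with `1 ≤ p` and `1 ≤ q` (equivalently `p ≤ n` and `q ≤ n`). -/
structure DegreePair (m p q : ℕ) : Prop where
  one_le_left : 1 ≤ p
  one_le_right : 1 ≤ q
  add_eq : p + q = m + 2

namespace DegreePair

variable {m p q : ℕ}

theorem left (d : DegreePair m p q) : p + (m + 1 - p) = m + 1 := by
  have := d.one_le_right; have := d.add_eq; omega

theorem right (d : DegreePair m p q) : q + (m + 1 - q) = m + 1 := by
  have := d.one_le_left; have := d.add_eq; omega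

theorem left' (d : DegreePair m p q) : (m + 1 - p) + p = m + 1 := by
  have := d.left; omega

theorem right' (d : DegreePair m p q) : (m + 1 - q) + q = m + 1 := by
  have := d.right; omega

theorem bdLeft (d : DegreePair m p q) : (p - 1) + (m + 1 - p) = m := by
  have := d.left; have := d.one_le_left; omega

theorem bdRight (d : DegreePair m p q) : (q - 1) + (m + 1 - q) = m := by
  have := d.right; have := d.one_le_right; omega

theorem bdLeft' (d : DegreePair m p q) : (m + 1 - p) + (p - 1) = m := by
  have := d.bdLeft; omega

theorem bdRight' (d : DegreePair m p q) : (m + 1 - q) + (q - 1) = m := by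
  have := d.bdRight; omega

end DegreePair

variable (m p q : ℕ) (Z : Type*) [TopologicalSpace Z]
  [ChartedSpace (EuclideanHalfSpace (m + 1)) Z] [IsManifold (𝓡∂ (m + 1)) ∞ Z]

/-- Quadruples of arbitrary fields of alternating forms, of the same degrees as the flows. -/
abbrev RawFlow : Type _ :=
  RawForm (𝓡∂ (m + 1)) Z (m + 1 - p) × RawForm (𝓡∂ (m + 1)) Z (m + 1 - q) ×
    RawForm (𝓡 m) ((𝓡∂ (m + 1)).boundary Z) (m + 1 - p) ×
    RawForm (𝓡 m) ((𝓡∂ (m + 1)).boundary Z) (m + 1 - q)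

/-- The flows `ℱ = Ωⁿ⁻ᵖ(Z) × Ωⁿ⁻ᑫ(Z) × Ωⁿ⁻ᵖ(∂Z) × Ωⁿ⁻ᑫ(∂Z)`, `n = m + 1`. -/
abbrev Flow : Type _ :=
  Form (𝓡∂ (m + 1)) Z (m + 1 - p) × Form (𝓡∂ (m + 1)) Z (m + 1 - q) ×
    Form (𝓡 m) ((𝓡∂ (m + 1)).boundary Z) (m + 1 - p) ×
    Form (𝓡 m) ((𝓡∂ (m + 1)).boundary Z) (m + 1 - q)

/-- The efforts `ℰ = Ωᵖ(Z) × Ωᑫ(Z) × Ωᵖ⁻¹(∂Z) × Ωᑫ⁻¹(∂Z)`, the (smooth) dual of the space of flows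
for the pairing `⟨e|f⟩ = ∫ e ∧ f`. -/
abbrev Effort : Type _ :=
  Form (𝓡∂ (m + 1)) Z p × Form (𝓡∂ (m + 1)) Z q ×
    Form (𝓡 m) ((𝓡∂ (m + 1)).boundary Z) (p - 1) ×
    Form (𝓡 m) ((𝓡∂ (m + 1)).boundary Z) (q - 1)

/-- The space `𝒮 = Ωⁿ⁻ᵖ(∂Z)` of the port variables `e_u`, `n = m + 1`. -/
abbrev PortInput : Type _ := Form (𝓡 m) ((𝓡∂ (m + 1)).boundary Z) (m + 1 - p)

/-- The space `𝒴 = Ωᵖ⁻¹(∂Z)` of the port variables `f_y`. -/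
abbrev PortOutput : Type _ := Form (𝓡 m) ((𝓡∂ (m + 1)).boundary Z) (p - 1)

/-- The space `ℱ × 𝒴 × ℰ × 𝒮` of all `(f, f_y, e, e_u)`. -/
abbrev BondSpace : Type _ :=
  Flow m p q Z × PortOutput m p Z × Effort m p q Z × PortInput m p Z

/-- The map `B = [0 I 0]ᵀ : 𝒮 → ℱ`, `e_u ↦ (0, 0, e_u, 0)`. -/
def portMap : PortInput m p Z →ₗ[ℝ] Flow m p q Z :=
  LinearMap.inr ℝ _ _ ∘ₗ LinearMap.inr ℝ _ _ ∘ₗ LinearMap.inl ℝ _ _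

/-- The transpose `Bᵀ = [0 I 0] : ℱ → 𝒮`, `f ↦ f₃`. -/
def portMapTranspose : Flow m p q Z →ₗ[ℝ] PortInput m p Z :=
  LinearMap.fst ℝ _ _ ∘ₗ LinearMap.snd ℝ _ _ ∘ₗ LinearMap.snd ℝ _ _

variable {m p q Z}

/-- Forgetting smoothness. -/
def Flow.toRaw : Flow m p q Z →ₗ[ℝ] RawFlow m p q Z :=
  (Submodule.subtype _).prodMap
    ((Submodule.subtype _).prodMap ((Submodule.subtype _).prodMap (Submodule.subtype _)))

variable (d : DegreePair m p q)
  (g : Bundle.ContMDiffRiemannianMetric (𝓡∂ (m + 1)) ∞ (EuclideanSpace ℝ (Fin (m + 1)))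
    (fun x : Z => TangentSpace (𝓡∂ (m + 1)) x))
  (o : ManifoldOrientation (𝓡∂ (m + 1)) Z)

/-- The Hodge star of `Z`. -/
def starInterior {k l : ℕ} (h : k + l = m + 1) :
    RawForm (𝓡∂ (m + 1)) Z k →ₗ[ℝ] RawForm (𝓡∂ (m + 1)) Z l :=
  hodgeStar h g.toRiemannianMetric o.toFun

/-- The Hodge star of `∂Z`, for the induced metric and orientation. -/
def starBoundary {k l : ℕ} (h : k + l = m) :
    RawForm (𝓡 m) ((𝓡∂ (m + 1)).boundary Z) k →ₗ[ℝ]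
      RawForm (𝓡 m) ((𝓡∂ (m + 1)).boundary Z) l :=
  hodgeStar h (boundaryMetric g.toRiemannianMetric) (boundaryOrientation o.toFun)

/-- The Hodge star `⋆e` of an effort, component by component. -/
def starEffort : Effort m p q Z →ₗ[ℝ] RawFlow m p q Z :=
  (starInterior g o d.left ∘ₗ Submodule.subtype _).prodMap
    ((starInterior g o d.right ∘ₗ Submodule.subtype _).prodMap
      ((starBoundary g o d.bdLeft ∘ₗ Submodule.subtype _).prodMap
        (starBoundary g o d.bdRight ∘ₗ Submodule.subtype _)))

/-- The linear map `(f, f_y, e, e_u) ↦ -𝒜 f`. -/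
def negFlowMap (A : Flow m p q Z →ₗ[ℝ] Flow m p q Z) : BondSpace m p q Z →ₗ[ℝ] RawFlow m p q Z :=
  -(Flow.toRaw ∘ₗ A ∘ₗ LinearMap.fst ℝ _ _)

/-- The linear map `(f, f_y, e, e_u) ↦ ⋆e + B e_u`. -/
def effortMap : BondSpace m p q Z →ₗ[ℝ] RawFlow m p q Z :=
  starEffort d g o ∘ₗ LinearMap.fst ℝ _ _ ∘ₗ LinearMap.snd ℝ _ _ ∘ₗ LinearMap.snd ℝ _ _ +
    Flow.toRaw ∘ₗ portMap m p q Z ∘ₗ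
      LinearMap.snd ℝ _ _ ∘ₗ LinearMap.snd ℝ _ _ ∘ₗ LinearMap.snd ℝ _ _

/-- The linear map `(f, f_y, e, e_u) ↦ f_y`. -/
def outputMap : BondSpace m p q Z →ₗ[ℝ]
    RawForm (𝓡 m) ((𝓡∂ (m + 1)).boundary Z) (p - 1) :=
  Submodule.subtype _ ∘ₗ LinearMap.fst ℝ _ _ ∘ₗ LinearMap.snd ℝ _ _

/-- The linear map `(f, f_y, e, e_u) ↦ ⋆Bᵀ f`. -/
def starTransposeMap : BondSpace m p q Z →ₗ[ℝ]
    RawForm (𝓡 m) ((𝓡∂ (m + 1)).boundary Z) (p - 1) :=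
  starBoundary g o d.bdLeft' ∘ₗ Submodule.subtype _ ∘ₗ portMapTranspose m p q Z ∘ₗ
    LinearMap.fst ℝ _ _

/-- The subspace `𝒟 = {(f, f_y, e, e_u) | -𝒜 f = ⋆e + B e_u, f_y = ⋆Bᵀ f}`. -/
def diracStructure (A : Flow m p q Z →ₗ[ℝ] Flow m p q Z) : Submodule ℝ (BondSpace m p q Z) :=
  LinearMap.eqLocus (negFlowMap A) (effortMap d g o) ⊓
    LinearMap.eqLocus outputMap (starTransposeMap d g o)

theorem mem_diracStructure_iff {A : Flow m p q Z →ₗ[ℝ] Flow m p q Z} {f : Flow m p q Z}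
    {fy : PortOutput m p Z} {e : Effort m p q Z} {eu : PortInput m p Z} :
    ((f, fy, e, eu) : BondSpace m p q Z) ∈ diracStructure d g o A ↔
      -(A f).toRaw = starEffort d g o e + (portMap m p q Z eu).toRaw ∧
      (fy : RawForm (𝓡 m) ((𝓡∂ (m + 1)).boundary Z) (p - 1)) =
        starBoundary g o d.bdLeft' (portMapTranspose m p q Z f) :=
  Iff.rfl

variable [T2Space Z] [CompactSpace Z]

/-- `∫_Z α ∧ β`. -/
def integralInterior {k l : ℕ} (h : k + l = m + 1) (α : RawForm (𝓡∂ (m + 1)) Z k)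
    (β : RawForm (𝓡∂ (m + 1)) Z l) : ℝ :=
  formIntegral o.toFun (α.wedge h β)

/-- `∫_{∂Z} α ∧ β`. -/
def integralBoundary {k l : ℕ} (h : k + l = m)
    (α : RawForm (𝓡 m) ((𝓡∂ (m + 1)).boundary Z) k)
    (β : RawForm (𝓡 m) ((𝓡∂ (m + 1)).boundary Z) l) : ℝ :=
  formIntegral (boundaryOrientation o.toFun) (α.wedge h β)

/-- The duality pairing `⟨e|f⟩ = ∫ e ∧ f` of efforts and flows, the sum of the integrals over `Z`
of the first two components and over `∂Z` of the last two. -/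
def pairing : Effort m p q Z → Flow m p q Z → ℝ
  | (e₁, e₂, e₃, e₄), (f₁, f₂, f₃, f₄) =>
    integralInterior o d.left e₁ f₁ + integralInterior o d.right e₂ f₂ +
      integralBoundary o d.bdLeft e₃ f₃ + integralBoundary o d.bdRight e₄ f₄

/-- The duality pairing `⟨e_u|f_y⟩ = ∫_{∂Z} e_u ∧ f_y` of port variables. -/
def portPairing (eu : PortInput m p Z) (fy : PortOutput m p Z) : ℝ :=
  integralBoundary o d.bdLeft' eu fy

/-- `∫_{Z + ∂Z} f ∧ ⋆f'` for flows `f`, `f'`: the first two components are integrated over `Z`, the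
last two over `∂Z`. -/
def starPairing : Flow m p q Z → Flow m p q Z → ℝ
  | (f₁, f₂, f₃, f₄), (f₁', f₂', f₃', f₄') =>
    integralInterior o d.left' f₁ (starInterior g o d.left' f₁') +
      integralInterior o d.right' f₂ (starInterior g o d.right' f₂') +
      integralBoundary o d.bdLeft' f₃ (starBoundary g o d.bdLeft' f₃') +
      integralBoundary o d.bdRight' f₄ (starBoundary g o d.bdRight' f₄')

/-- The noncanonical pairing
`⟨e¹|f²⟩ + ⟨e²|f¹⟩ + ∫_{Z + ∂Z} (f¹ ∧ ⋆𝒜f² + f² ∧ ⋆𝒜f¹) + ⟨e_u¹|f_y²⟩ + ⟨e_u²|f_y¹⟩`. -/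
def noncanonicalPairing (A : Flow m p q Z →ₗ[ℝ] Flow m p q Z) :
    BondSpace m p q Z → BondSpace m p q Z → ℝ
  | (f₁, fy₁, e₁, eu₁), (f₂, fy₂, e₂, eu₂) =>
    pairing d o e₁ f₂ + pairing d o e₂ f₁ +
      (starPairing d g o f₁ (A f₂) + starPairing d g o f₂ (A f₁)) +
      portPairing d o eu₁ fy₂ + portPairing d o eu₂ fy₁

end Dirac

end NoncanDirac

end

/-! Write `(f, f')` for `∫ f ∧ ⋆f'` over `Z + ∂Z`, which is the `L²` inner product of flows. The
structure `𝒟` is the common kernel of two linear defects, `Ψ = ⋆e + B e_u + 𝒜 f` and `Φ = f_y - ⋆Bᵀ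
f`, and the noncanonical pairing of `x¹` and `x²` can be rewritten as `(f¹, Ψ(x²)) + (f², Ψ(x¹)) +
⟨e_u¹|Φ(x²)⟩ + ⟨e_u²|Φ(x¹)⟩`; this is `noncanonicalPairing_eq_defect`. Two facts give the identity.
First, `∫ f ∧ ⋆⋆e = ∫ e ∧ f`, because `⋆⋆` and graded commutativity produce the same sign
(`wedgeIntegral_formStar_formStar`). Second, the terms `∫ f₃ ∧ ⋆e_u` coming from `Ψ` cancel the
terms `∫ e_u ∧ ⋆f₃` coming from `Φ`, because the `L²` product is symmetric
(`wedgeIntegral_formStar_comm`). The terms with `𝒜` are absorbed as they stand, so nothing is needed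
of `𝒜` beyond linearity.

The inclusion of `𝒟` in its orthogonal complement is then immediate. Conversely, if `y` is
orthogonal to `𝒟`, then `(f, Ψ(y)) + ⟨e_u|Φ(y)⟩ = 0` whenever `f` and `e_u` are components of an
element of `𝒟`. Since `⋆` is onto, every pair `(f, e_u)` occurs (`exists_mem_diracStructure`).
Definiteness of the `L²` product then forces `Ψ(y) = 0` and `Φ(y) = 0`. Neither the exterior
derivative nor Stokes' theorem enters.

The remaining work is to justify these manipulations for smooth forms: `⋆` preserves smoothness, the
integral is linear on smooth forms and detects nonnegative ones, and the metric and orientation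
induced on `∂Z` are again smooth and continuous. -/

noncomputable section

namespace NoncanDirac

/-! ### Pointwise algebra: wedge product, Hodge star and orientation signs. -/

section ExteriorAlgebra

variable {V : Type*} [AddCommGroup V] [Module ℝ V] {k l n : ℕ}

/-- The sum over shuffles defining the wedge product, as a sum over all permutations. -/
theorem factorial_mul_wedge_apply (h : k + l = n) (α : V [⋀^Fin k]→ₗ[ℝ] ℝ)
    (β : V [⋀^Fin l]→ₗ[ℝ] ℝ) (v : Fin n → V) :
    ((k.factorial * l.factorial : ℕ) : ℝ) * wedge h α β v =
      ∑ π : Equiv.Perm (Fin n), ((Equiv.Perm.sign π : ℤ) : ℝ) *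
        (α (fun i => v (π (splitFin h (Sum.inl i)))) *
          β (fun i => v (π (splitFin h (Sum.inr i))))) := by
  -- Each shuffle stands for a class of `k! l!` permutations with equal contributions, so the
  -- alternatization of the plain tensor product is `k! l!` times the wedge.
  have key := congrArg
    (fun F => (LinearMap.mul' ℝ ℝ) (F (fun i => v (splitFin h i))))
    (MultilinearMap.domCoprod_alternization_eq α β)
  simp only [Fintype.card_fin, AlternatingMap.smul_apply, map_nsmul] at key
  rw [nsmul_eq_mul] at key
  refine Eq.trans key.symm ?_
  rw [MultilinearMap.alternatization_apply, map_sum]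
  refine Fintype.sum_equiv (splitFin h).permCongr _ _ (fun σ => ?_)
  rw [Equiv.Perm.sign_permCongr]
  simp only [Equiv.permCongr_apply, Equiv.symm_apply_apply]
  rw [Units.smul_def, map_zsmul, zsmul_eq_mul]
  rfl

theorem factorial_mul_ne_zero (k l : ℕ) : ((k.factorial * l.factorial : ℕ) : ℝ) ≠ 0 := by
  positivity

/-- Bilinearity is read off from the sum over all permutations, which avoids handling
representatives of shuffle classes; the factor `k! l!` is then cancelled. -/
theorem wedge_add_left (h : k + l = n) (α α' : V [⋀^Fin k]→ₗ[ℝ] ℝ) (β : V [⋀^Fin l]→ₗ[ℝ] ℝ) :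
    wedge h (α + α') β = wedge h α β + wedge h α' β := by
  ext v
  apply mul_left_cancel₀ (factorial_mul_ne_zero k l)
  simp only [AlternatingMap.add_apply, mul_add, factorial_mul_wedge_apply, add_mul,
    Finset.sum_add_distrib]

theorem wedge_add_right (h : k + l = n) (α : V [⋀^Fin k]→ₗ[ℝ] ℝ) (β β' : V [⋀^Fin l]→ₗ[ℝ] ℝ) :
    wedge h α (β + β') = wedge h α β + wedge h α β' := by
  ext v
  apply mul_left_cancel₀ (factorial_mul_ne_zero k l)
  simp only [AlternatingMap.add_apply, mul_add, factorial_mul_wedge_apply,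
    Finset.sum_add_distrib]

theorem wedge_smul_left (h : k + l = n) (r : ℝ) (α : V [⋀^Fin k]→ₗ[ℝ] ℝ)
    (β : V [⋀^Fin l]→ₗ[ℝ] ℝ) : wedge h (r • α) β = r • wedge h α β := by
  ext v
  apply mul_left_cancel₀ (factorial_mul_ne_zero k l)
  simp only [AlternatingMap.smul_apply, smul_eq_mul, mul_left_comm _ r,
    factorial_mul_wedge_apply, mul_assoc, Finset.mul_sum]

theorem wedge_smul_right (h : k + l = n) (r : ℝ) (α : V [⋀^Fin k]→ₗ[ℝ] ℝ)
    (β : V [⋀^Fin l]→ₗ[ℝ] ℝ) : wedge h α (r • β) = r • wedge h α β := by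
  ext v
  apply mul_left_cancel₀ (factorial_mul_ne_zero k l)
  simp only [AlternatingMap.smul_apply, smul_eq_mul, mul_left_comm _ r,
    factorial_mul_wedge_apply, Finset.mul_sum]

/-- The permutation exchanging the first `k` and the last `l` indices. -/
def blockSwap (h : k + l = n) (h' : l + k = n) : Equiv.Perm (Fin n) :=
  (splitFin h).symm.trans ((Equiv.sumComm _ _).trans (splitFin h'))

@[simp] theorem blockSwap_inl (h : k + l = n) (h' : l + k = n) (i : Fin k) :
    blockSwap h h' (splitFin h (Sum.inl i)) = splitFin h' (Sum.inr i) := by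
  simp [blockSwap]

@[simp] theorem blockSwap_inr (h : k + l = n) (h' : l + k = n) (i : Fin l) :
    blockSwap h h' (splitFin h (Sum.inr i)) = splitFin h' (Sum.inl i) := by
  simp [blockSwap]

/-- The sign of the permutation exchanging the first `k` and the last `l` indices. -/
def blockSign (h : k + l = n) (h' : l + k = n) : ℝ :=
  ((Equiv.Perm.sign (blockSwap h h') : ℤ) : ℝ)

theorem sign_mul_self (π : Equiv.Perm (Fin n)) :
    ((Equiv.Perm.sign π : ℤ) : ℝ) * ((Equiv.Perm.sign π : ℤ) : ℝ) = 1 := by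
  rw [← Int.cast_mul, Int.units_coe_mul_self, Int.cast_one]

/-- The explicit value `(-1)^(kl)` is never needed: it suffices that the sign squares to one and
that the same sign governs both graded commutativity and `⋆⋆`. -/
theorem blockSign_mul_self (h : k + l = n) (h' : l + k = n) :
    blockSign h h' * blockSign h h' = 1 :=
  sign_mul_self _

/-- Graded commutativity of the wedge product. -/
theorem wedge_comm (h : k + l = n) (h' : l + k = n) (α : V [⋀^Fin k]→ₗ[ℝ] ℝ)
    (β : V [⋀^Fin l]→ₗ[ℝ] ℝ) : wedge h' β α = blockSign h h' • wedge h α β := by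
  ext v
  apply mul_left_cancel₀ (factorial_mul_ne_zero l k)
  rw [AlternatingMap.smul_apply, smul_eq_mul, mul_left_comm, mul_comm l.factorial,
    factorial_mul_wedge_apply h, mul_comm k.factorial, factorial_mul_wedge_apply h',
    Finset.mul_sum]
  -- Composing on the right with the block swap exchanges the arguments of `α` and `β` and
  -- multiplies the sign of `π` by `blockSign h h'`.
  refine Fintype.sum_equiv (Equiv.mulRight (blockSwap h h')) _ _ (fun π => ?_)
  simp only [Equiv.coe_mulRight, Equiv.Perm.mul_apply, blockSwap_inl, blockSwap_inr,
    Equiv.Perm.sign_mul, Units.val_mul, Int.cast_mul]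
  rw [show ((Equiv.Perm.sign (blockSwap h h') : ℤ) : ℝ) = blockSign h h' from rfl]
  linear_combination (-((Equiv.Perm.sign π : ℤ) : ℝ) *
    (β (fun i => v (π (splitFin h' (Sum.inl i)))) *
      α (fun i => v (π (splitFin h' (Sum.inr i)))))) * blockSign_mul_self h h'

theorem insertFirst_apply (h : k + l = n) (μ : V [⋀^Fin n]→ₗ[ℝ] ℝ) (u : Fin k → V)
    (w : Fin l → V) :
    insertFirst h μ u w = μ (fun i => Sum.elim u w ((splitFin h).symm i)) := rfl

theorem alternatingMap_sum_apply {ι : Type*} (s : Finset ι) (f : ι → V [⋀^Fin k]→ₗ[ℝ] ℝ)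
    (v : Fin k → V) : (∑ i ∈ s, f i) v = ∑ i ∈ s, f i v := by
  classical
  induction s using Finset.induction_on with
  | empty => simp
  | insert a s ha ih => simp [Finset.sum_insert ha, ih]

theorem hodgeInBasis_apply (h : k + l = n) (b : Module.Basis (Fin n) ℝ V)
    (o : Orientation ℝ V (Fin n)) (θ : V [⋀^Fin k]→ₗ[ℝ] ℝ) (w : Fin l → V) :
    hodgeInBasis h b o θ w = (k.factorial : ℝ)⁻¹ * ∑ i : Fin k → Fin n, θ (fun a => b (i a)) *
      (frameSign o b * b.det (fun j => Sum.elim (fun a => b (i a)) w ((splitFin h).symm j))) := by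
  simp only [hodgeInBasis, LinearMap.coe_mk, AddHom.coe_mk, AlternatingMap.smul_apply,
    alternatingMap_sum_apply, smul_eq_mul, insertFirst_apply]

theorem det_comp_perm (b : Module.Basis (Fin n) ℝ V) (π : Equiv.Perm (Fin n)) :
    b.det (fun j => b (π j)) = ((Equiv.Perm.sign π : ℤ) : ℝ) := by
  have := b.det.map_perm b π
  rw [b.det_self, Units.smul_def, zsmul_one] at this
  exact this

/-- The Hodge star on the vectors of the basis which defines it. -/
theorem hodgeInBasis_apply_perm (h : k + l = n) (b : Module.Basis (Fin n) ℝ V)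
    (o : Orientation ℝ V (Fin n)) (θ : V [⋀^Fin k]→ₗ[ℝ] ℝ) (π : Equiv.Perm (Fin n)) :
    hodgeInBasis h b o θ (fun j => b (π (splitFin h (Sum.inr j)))) =
      frameSign o b * ((Equiv.Perm.sign π : ℤ) : ℝ) *
        θ (fun i => b (π (splitFin h (Sum.inl i)))) := by
  rw [hodgeInBasis_apply, inv_mul_eq_iff_eq_mul₀ (by positivity)]
  set t : ℝ := frameSign o b * ((Equiv.Perm.sign π : ℤ) : ℝ) *
        θ (fun i => b (π (splitFin h (Sum.inl i)))) with ht
  -- The nonzero terms of the sum are those where `i` enumerates the indices missing from the last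
  -- block. There are `k!` of them, indexed by a permutation `τ` of the first block, and all equal
  -- `t`; this cancels the `1 / k!` of the definition.
  have hc : (k.factorial : ℝ) * t = ∑ _τ : Equiv.Perm (Fin k), t := by
    simp [Fintype.card_perm]
  rw [hc]
  symm
  refine Fintype.sum_of_injective (fun τ a => π (splitFin h (Sum.inl (τ a)))) ?_ _ _ ?_ ?_
  · intro τ τ' hτ
    ext a
    simpa [Fin.ext_iff] using congrFun hτ a
  -- If the determinant is nonzero, `i` is injective and avoids the last block of `π`, hence
  -- permutes the first block.
  · intro i hi
    refine mul_eq_zero_of_right _ (mul_eq_zero_of_right _ ?_)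
    by_contra hne
    apply hi
    have hinj : Function.Injective
        (Sum.elim i (fun j => π (splitFin h (Sum.inr j)))) := by
      intro x y hxy
      by_contra hxy'
      apply hne
      refine b.det.map_eq_zero_of_eq _ (i := splitFin h x) (j := splitFin h y) ?_
        (fun hh => hxy' ((splitFin h).injective hh))
      rw [Equiv.symm_apply_apply, Equiv.symm_apply_apply]
      have hb := congrArg b hxy
      rcases x with x | x <;> rcases y with y | y <;> simpa using hb
    have hex : ∀ a, ∃ a', π (splitFin h (Sum.inl a')) = i a := by
      intro a
      obtain ⟨x, hx⟩ := ((splitFin h).trans π).surjective (i a)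
      rcases x with x | x
      · exact ⟨x, hx⟩
      · exact absurd (hinj (a₁ := Sum.inr x) (a₂ := Sum.inl a) hx) (by simp)
    choose τ hτ using hex
    have hτi : Function.Injective τ := by
      intro a a' haa
      have : i a = i a' := by rw [← hτ a, ← hτ a', haa]
      simpa using hinj (a₁ := Sum.inl a) (a₂ := Sum.inl a') this
    exact ⟨Equiv.ofBijective τ (Finite.injective_iff_bijective.1 hτi), funext hτ⟩
  -- Both `θ` and the determinant acquire the sign of `τ`, so the term does not depend on `τ`.
  · intro τ
    let ρ : Equiv.Perm (Fin n) := (splitFin h).permCongr (Equiv.sumCongr τ (Equiv.refl _))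
    have hρ : Equiv.Perm.sign ρ = Equiv.Perm.sign τ := by
      simp only [ρ, Equiv.Perm.sign_permCongr]
      rw [show (Equiv.sumCongr τ (Equiv.refl (Fin l)) : Equiv.Perm (Fin k ⊕ Fin l)) =
        Equiv.Perm.sumCongr τ (1 : Equiv.Perm (Fin l)) from rfl, Equiv.Perm.sign_sumCongr]
      simp
    have h1 : (fun j => Sum.elim (fun a => b (π (splitFin h (Sum.inl (τ a)))))
        (fun j => b (π (splitFin h (Sum.inr j)))) ((splitFin h).symm j)) =
        fun j => b ((π * ρ) j) := by
      funext j
      obtain ⟨x, rfl⟩ := (splitFin h).surjective j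
      rcases x with x | x <;> simp [ρ, Equiv.permCongr_apply]
    have h2 := θ.map_perm (fun i => b (π (splitFin h (Sum.inl i)))) τ
    rw [Units.smul_def, zsmul_eq_mul] at h2
    have h3 : θ (fun a => b (π (splitFin h (Sum.inl (τ a))))) =
      ((Equiv.Perm.sign τ : ℤ) : ℝ) * θ (fun i => b (π (splitFin h (Sum.inl i)))) := h2
    rw [h1, h3, det_comp_perm, Equiv.Perm.sign_mul, hρ, ht, Units.val_mul, Int.cast_mul]
    linear_combination (-(frameSign o b * ((Equiv.Perm.sign π : ℤ) : ℝ) *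
        θ (fun i => b (π (splitFin h (Sum.inl i)))))) * sign_mul_self τ

theorem frameSign_mul_self (o : Orientation ℝ V (Fin n)) (w : Fin n → V) :
    frameSign o w * frameSign o w = 1 := by
  unfold frameSign; split_ifs <;> norm_num

theorem exists_perm_splitFin_inl (h : k + l = n) {v : Fin k → Fin n}
    (hv : Function.Injective v) :
    ∃ π : Equiv.Perm (Fin n), ∀ i, π (splitFin h (Sum.inl i)) = v i := by
  classical
  have hinj : Function.Injective (fun i : Fin k => splitFin h (Sum.inl i)) :=
    (splitFin h).injective.comp Sum.inl_injective
  let e : {x // x ∈ Set.range (fun i : Fin k => splitFin h (Sum.inl i))} ≃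
      {x // x ∈ Set.range v} :=
    (Equiv.ofInjective _ hinj).symm.trans (Equiv.ofInjective v hv)
  refine ⟨e.extendSubtype, fun i => ?_⟩
  rw [Equiv.extendSubtype_apply_of_mem e _ ⟨i, rfl⟩]
  have : (⟨splitFin h (Sum.inl i), ⟨i, rfl⟩⟩ :
    {x // x ∈ Set.range (fun i : Fin k => splitFin h (Sum.inl i))}) =
      Equiv.ofInjective _ hinj i := rfl
  simp only [e, Equiv.trans_apply]
  rw [this, Equiv.symm_apply_apply]
  rfl

/-- An alternating form is determined by its values on tuples of distinct basis vectors, and each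
such tuple is the first block of some permutation. This is the shape in which
`hodgeInBasis_apply_perm` applies. -/
theorem ext_basis_perm (h : k + l = n) (b : Module.Basis (Fin n) ℝ V)
    {α β : V [⋀^Fin k]→ₗ[ℝ] ℝ}
    (hab : ∀ π : Equiv.Perm (Fin n), α (fun i => b (π (splitFin h (Sum.inl i)))) =
      β (fun i => b (π (splitFin h (Sum.inl i))))) : α = β := by
  refine b.ext_alternating (fun v hv => ?_)
  obtain ⟨π, hπ⟩ := exists_perm_splitFin_inl h hv
  simpa only [hπ] using hab π

/-- The square of the Hodge star. -/
theorem hodgeInBasis_hodgeInBasis (h : k + l = n) (h' : l + k = n)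
    (b : Module.Basis (Fin n) ℝ V) (o : Orientation ℝ V (Fin n)) (θ : V [⋀^Fin k]→ₗ[ℝ] ℝ) :
    hodgeInBasis h' b o (hodgeInBasis h b o θ) = blockSign h h' • θ := by
  refine ext_basis_perm h b (fun π => ?_)
  -- With `π = ρ * blockSwap h h'`, the first block of `π` is the last block of `ρ` for the opposite
  -- splitting, so the formula on basis vectors can be applied twice.
  obtain ⟨ρ, rfl⟩ := (Equiv.mulRight (blockSwap h h')).surjective π
  have h1 := hodgeInBasis_apply_perm h' b o (hodgeInBasis h b o θ) ρ
  have h2 := hodgeInBasis_apply_perm h b o θ (ρ * blockSwap h h')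
  simp only [Equiv.coe_mulRight, Equiv.Perm.mul_apply, blockSwap_inl, blockSwap_inr,
    Equiv.Perm.sign_mul, Units.val_mul, Int.cast_mul, AlternatingMap.smul_apply,
    smul_eq_mul] at h1 h2 ⊢
  rw [h1, h2]
  change _ = blockSign h h' * _
  change _ * (_ * (_ * blockSign h h') * _) = _
  linear_combination (blockSign h h' * θ (fun i => b (ρ (splitFin h' (Sum.inr i))))) *
    (((Equiv.Perm.sign ρ : ℤ) : ℝ) * ((Equiv.Perm.sign ρ : ℤ) : ℝ) * frameSign_mul_self o b
      + sign_mul_self ρ)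

/-- The inner product of forms in a basis, up to a factor. -/
def basisInner (h : k + l = n) (b : Module.Basis (Fin n) ℝ V) (α β : V [⋀^Fin k]→ₗ[ℝ] ℝ) : ℝ :=
  ((k.factorial * l.factorial : ℕ) : ℝ)⁻¹ * ∑ π : Equiv.Perm (Fin n),
    α (fun i => b (π (splitFin h (Sum.inl i)))) * β (fun i => b (π (splitFin h (Sum.inl i))))

/-- In the term of a permutation, its sign occurs once in the wedge and once in the star, and
cancels. What remains is symmetric in `α` and `β`, and a sum of squares when `α = β`; symmetry and
positivity of the `L²` product both come from here. -/
theorem wedge_hodgeInBasis (h : k + l = n) (b : Module.Basis (Fin n) ℝ V)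
    (o : Orientation ℝ V (Fin n)) (α β : V [⋀^Fin k]→ₗ[ℝ] ℝ) :
    wedge h α (hodgeInBasis h b o β) = (basisInner h b α β * frameSign o b) • b.det := by
  have hb : wedge h α (hodgeInBasis h b o β) b = basisInner h b α β * frameSign o b := by
    rw [basisInner, mul_assoc, eq_inv_mul_iff_mul_eq₀ (factorial_mul_ne_zero k l),
      factorial_mul_wedge_apply, Finset.sum_mul]
    refine Finset.sum_congr rfl (fun π _ => ?_)
    rw [hodgeInBasis_apply_perm]
    linear_combination (α (fun i => b (π (splitFin h (Sum.inl i)))) *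
      β (fun i => b (π (splitFin h (Sum.inl i)))) * frameSign o b) * sign_mul_self π
  rw [← hb]
  exact AlternatingMap.eq_smul_basis_det _ _

theorem basisInner_comm (h : k + l = n) (b : Module.Basis (Fin n) ℝ V)
    (α β : V [⋀^Fin k]→ₗ[ℝ] ℝ) : basisInner h b α β = basisInner h b β α := by
  simp only [basisInner, mul_comm (α _)]

theorem basisInner_self_nonneg (h : k + l = n) (b : Module.Basis (Fin n) ℝ V)
    (α : V [⋀^Fin k]→ₗ[ℝ] ℝ) : 0 ≤ basisInner h b α α :=
  mul_nonneg (by positivity) (Finset.sum_nonneg fun _ _ => mul_self_nonneg _)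

theorem eq_zero_of_basisInner_self (h : k + l = n) (b : Module.Basis (Fin n) ℝ V)
    {α : V [⋀^Fin k]→ₗ[ℝ] ℝ} (hα : basisInner h b α α = 0) : α = 0 := by
  refine ext_basis_perm h b (fun π => ?_)
  have h1 := (mul_eq_zero.1 hα).resolve_left (inv_ne_zero (factorial_mul_ne_zero k l))
  rw [Finset.sum_eq_zero_iff_of_nonneg (fun _ _ => mul_self_nonneg _)] at h1
  exact mul_self_eq_zero.1 (h1 π (Finset.mem_univ _))

theorem wedge_hodgeInBasis_comm (h : k + l = n) (b : Module.Basis (Fin n) ℝ V)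
    (o : Orientation ℝ V (Fin n)) (α β : V [⋀^Fin k]→ₗ[ℝ] ℝ) :
    wedge h α (hodgeInBasis h b o β) = wedge h β (hodgeInBasis h b o α) := by
  rw [wedge_hodgeInBasis, wedge_hodgeInBasis, basisInner_comm]

theorem isPosFrame_basis_iff {o : Orientation ℝ V (Fin n)} {c : Module.Basis (Fin n) ℝ V} :
    IsPosFrame o c ↔ c.orientation = o :=
  ⟨fun ⟨b, hb, ho⟩ => by rw [← DFunLike.coe_injective hb, ho], fun ho => ⟨c, rfl, ho⟩⟩

/-- There are only two orientations, and the sign of `b.det c` tells whether `b` and `c` define the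
same one. -/
theorem isPosFrame_iff_of_det {o : Orientation ℝ V (Fin n)} (b c : Module.Basis (Fin n) ℝ V) :
    IsPosFrame o c ↔ (IsPosFrame o b ↔ 0 < b.det c) := by
  rw [isPosFrame_basis_iff, isPosFrame_basis_iff, ← b.orientation_eq_iff_det_pos]
  have hne := c.orientation_ne_iff_eq_neg o
  rcases b.orientation_eq_or_eq_neg o with rfl | rfl
  · simp [eq_comm]
  · rcases b.orientation_eq_or_eq_neg c.orientation with hc | hc
    · rw [hc]
      have : b.orientation ≠ -b.orientation := Module.Ray.ne_neg_self _
      simp [this]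
    · rw [hc]
      have : b.orientation ≠ -b.orientation := Module.Ray.ne_neg_self _
      simp [this]

theorem frameSign_mul_det (o : Orientation ℝ V (Fin n)) (b c : Module.Basis (Fin n) ℝ V) :
    frameSign o b * b.det c = frameSign o c * |b.det c| := by
  have h := isPosFrame_iff_of_det (o := o) b c
  have hne : b.det c ≠ 0 := (Module.Basis.isUnit_det b c).ne_zero
  unfold frameSign
  rcases lt_or_gt_of_ne hne with hd | hd
  · rw [abs_of_neg hd]
    simp only [hd.not_gt, iff_false] at h
    by_cases hb : IsPosFrame o b <;> simp [h, hb]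
  · rw [abs_of_pos hd]
    simp only [hd, iff_true] at h
    by_cases hb : IsPosFrame o b <;> simp [h, hb]

/-- The frame `c` need not be orthonormal: it will be a coordinate frame. Its orientation sign turns
the signed volume into a density, so for `α = β` the coefficient that is integrated is nonnegative
in every chart. -/
theorem frameSign_mul_wedge_hodgeInBasis (h : k + l = n) (b c : Module.Basis (Fin n) ℝ V)
    (o : Orientation ℝ V (Fin n)) (α β : V [⋀^Fin k]→ₗ[ℝ] ℝ) :
    frameSign o c * wedge h α (hodgeInBasis h b o β) c = basisInner h b α β * |b.det c| := by
  rw [wedge_hodgeInBasis, AlternatingMap.smul_apply, smul_eq_mul, mul_assoc, frameSign_mul_det]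
  linear_combination (basisInner h b α β * |b.det c|) * frameSign_mul_self o c

end ExteriorAlgebra

/-! ### The Hodge star in an arbitrary frame, through the Gram matrix. -/

section Coordinates

variable {V : Type*} [AddCommGroup V] [Module ℝ V] {k l n : ℕ}

theorem multilinearMap_apply_basis {N : Type*} [AddCommGroup N] [Module ℝ N]
    (b c : Module.Basis (Fin n) ℝ V) (α : MultilinearMap ℝ (fun _ : Fin k => V) N)
    (i : Fin k → Fin n) :
    α (fun a => b (i a)) =
      ∑ r : Fin k → Fin n, (∏ a, c.toMatrix b (r a) (i a)) • α (fun a => c (r a)) := by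
  have h1 : (fun a => b (i a)) = fun a => ∑ r, c.toMatrix b r (i a) • c r :=
    funext fun a => (c.sum_toMatrix_smul_self b (i a)).symm
  rw [h1, MultilinearMap.map_sum]
  exact Finset.sum_congr rfl fun r _ => MultilinearMap.map_smul_univ _ _ _

/-- Contracting over `b` amounts to contracting over `c` with the matrix `P Pᵀ`, where `P` expresses
`b` in `c`. For orthonormal `b` this is the inverse Gram matrix of `c`, in which `b` no longer
appears. -/
theorem sum_smul_basis_change {N : Type*} [AddCommGroup N] [Module ℝ N]
    (b c : Module.Basis (Fin n) ℝ V) (α : MultilinearMap ℝ (fun _ : Fin k => V) ℝ)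
    (β : MultilinearMap ℝ (fun _ : Fin k => V) N) :
    ∑ i : Fin k → Fin n, α (fun a => b (i a)) • β (fun a => b (i a)) =
      ∑ r : Fin k → Fin n, ∑ s : Fin k → Fin n,
        (∏ a, (c.toMatrix b * (c.toMatrix b).transpose) (r a) (s a)) •
          α (fun a => c (r a)) • β (fun a => c (s a)) := by
  have h1 : ∀ r s : Fin k → Fin n,
      (∏ a, (c.toMatrix b * (c.toMatrix b).transpose) (r a) (s a)) =
        ∑ i : Fin k → Fin n, (∏ a, c.toMatrix b (r a) (i a)) * ∏ a, c.toMatrix b (s a) (i a) := by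
    intro r s
    simp only [Matrix.mul_apply, Matrix.transpose_apply]
    rw [Finset.prod_univ_sum, Fintype.piFinset_univ]
    simp only [Finset.prod_mul_distrib]
  simp only [h1, Finset.sum_smul]
  calc _ = ∑ i : Fin k → Fin n, ∑ r : Fin k → Fin n, ∑ s : Fin k → Fin n,
        ((∏ a, c.toMatrix b (r a) (i a)) * ∏ a, c.toMatrix b (s a) (i a)) •
          α (fun a => c (r a)) • β (fun a => c (s a)) := by
        refine Finset.sum_congr rfl fun i _ => ?_
        rw [multilinearMap_apply_basis b c α, multilinearMap_apply_basis b c β, Finset.sum_smul]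
        refine Finset.sum_congr rfl fun r _ => ?_
        rw [Finset.smul_sum]
        refine Finset.sum_congr rfl fun s _ => ?_
        simp only [smul_smul, smul_eq_mul]
        congr 1
        ring
    _ = _ := by
        rw [Finset.sum_comm]
        exact Finset.sum_congr rfl fun r _ => Finset.sum_comm

/-- The Gram matrix of a frame. -/
def gramMatrix (γ : V →ₗ[ℝ] V →ₗ[ℝ] ℝ) (c : Fin n → V) : Matrix (Fin n) (Fin n) ℝ :=
  Matrix.of fun i j => γ (c i) (c j)

theorem gramMatrix_eq {γ : V →ₗ[ℝ] V →ₗ[ℝ] ℝ} {b : Module.Basis (Fin n) ℝ V}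
    (hb : ∀ i j, γ (b i) (b j) = if i = j then 1 else 0) (c : Module.Basis (Fin n) ℝ V) :
    gramMatrix γ c = (b.toMatrix c).transpose * b.toMatrix c := by
  ext i j
  rw [gramMatrix, Matrix.of_apply]
  nth_rw 1 [← b.sum_toMatrix_smul_self c i, ← b.sum_toMatrix_smul_self c j]
  simp only [map_sum, map_smul, LinearMap.sum_apply, LinearMap.smul_apply, hb, smul_eq_mul,
    Matrix.mul_apply, Matrix.transpose_apply, mul_ite, mul_one, mul_zero,
    Finset.sum_ite_eq', Finset.mem_univ, if_true]
  exact Finset.sum_congr rfl fun _ _ => mul_comm _ _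

theorem det_gramMatrix {γ : V →ₗ[ℝ] V →ₗ[ℝ] ℝ} {b : Module.Basis (Fin n) ℝ V}
    (hb : ∀ i j, γ (b i) (b j) = if i = j then 1 else 0) (c : Module.Basis (Fin n) ℝ V) :
    (gramMatrix γ c).det = b.det c ^ 2 := by
  rw [gramMatrix_eq hb, Matrix.det_mul, Matrix.det_transpose, Module.Basis.det_apply, sq]

theorem inv_gramMatrix {γ : V →ₗ[ℝ] V →ₗ[ℝ] ℝ} {b : Module.Basis (Fin n) ℝ V}
    (hb : ∀ i j, γ (b i) (b j) = if i = j then 1 else 0) (c : Module.Basis (Fin n) ℝ V) :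
    (gramMatrix γ c)⁻¹ = c.toMatrix b * (c.toMatrix b).transpose := by
  have h1 : b.toMatrix c * c.toMatrix b = 1 := b.toMatrix_mul_toMatrix_flip c
  apply Matrix.inv_eq_right_inv
  rw [gramMatrix_eq hb, Matrix.mul_assoc, ← Matrix.mul_assoc (b.toMatrix c), h1, Matrix.one_mul,
    ← Matrix.transpose_mul,
    c.toMatrix_mul_toMatrix_flip b, Matrix.transpose_one]

/-- Here `f` is any map, not only a permutation. The last factor depends on `f` alone, so it is a
constant when the frames vary from point to point. -/
theorem basis_det_comp (b c : Module.Basis (Fin n) ℝ V) (f : Fin n → Fin n) :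
    b.det (fun i => c (f i)) = b.det c * ((1 : Matrix (Fin n) (Fin n) ℝ).submatrix id f).det := by
  rw [b.det.eq_smul_basis_det c, AlternatingMap.smul_apply,
    smul_eq_mul, AlternatingMap.smul_apply, c.det_self, smul_eq_mul, mul_one, c.det_apply]
  congr 2
  ext i j
  simp [Module.Basis.toMatrix_apply, Matrix.one_apply, Finsupp.single_apply, eq_comm]

/-- The Hodge star of an orthonormal basis `b`, in an arbitrary basis `c`. -/
theorem hodgeInBasis_apply_basis (h : k + l = n) {γ : V →ₗ[ℝ] V →ₗ[ℝ] ℝ}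
    {b : Module.Basis (Fin n) ℝ V} (hb : ∀ i j, γ (b i) (b j) = if i = j then 1 else 0)
    (o : Orientation ℝ V (Fin n)) (θ : V [⋀^Fin k]→ₗ[ℝ] ℝ) (c : Module.Basis (Fin n) ℝ V)
    (J : Fin l → Fin n) :
    hodgeInBasis h b o θ (fun a => c (J a)) =
      (k.factorial : ℝ)⁻¹ * ∑ r : Fin k → Fin n, ∑ s : Fin k → Fin n,
        (∏ a, (gramMatrix γ c)⁻¹ (r a) (s a)) * (θ (fun a => c (r a)) *
          (frameSign o c * √(gramMatrix γ c).det *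
            ((1 : Matrix (Fin n) (Fin n) ℝ).submatrix id
              (fun i => Sum.elim s J ((splitFin h).symm i))).det)) := by
  -- The root of the Gram determinant is `|b.det c|`; the orientation sign of `c` restores the sign
  -- relative to `b`.
  have hs : frameSign o c * √(gramMatrix γ c).det = frameSign o b * b.det c := by
    rw [det_gramMatrix hb, Real.sqrt_sq_eq_abs, frameSign_mul_det]
  rw [hodgeInBasis_apply, hs, inv_gramMatrix hb]
  congr 1
  -- Currying makes the volume form a multilinear map in its first `k` arguments, with values in
  -- maps of the last `l`, so that the change of basis applies to it.
  have key := congrArg (fun F => F (fun a => c (J a)))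
    (sum_smul_basis_change b c θ.toMultilinearMap
      ((frameSign o b • b.det).domDomCongr (splitFin h).symm).toMultilinearMap.currySum)
  simp only [sum_apply, smul_apply, smul_eq_mul] at key
  refine Eq.trans key (Finset.sum_congr rfl fun r _ => Finset.sum_congr rfl fun s _ => ?_)
  congr 2
  rw [mul_assoc, ← basis_det_comp]
  change frameSign o b * b.det _ = _
  congr 2
  funext i
  obtain ⟨x, rfl⟩ := (splitFin h).surjective i
  rcases x with x | x <;> simp

end Coordinates

/-! ### Smoothness of wedge products and Hodge stars. -/

section SmoothForms

variable {n : ℕ} {H : Type*} [TopologicalSpace H]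
  {I : ModelWithCorners ℝ (EuclideanSpace ℝ (Fin n)) H}
  {M : Type*} [TopologicalSpace M] [ChartedSpace H M]

theorem contMDiffOn_det {s : Set M} {G : M → Matrix (Fin n) (Fin n) ℝ}
    (hG : ∀ i j, ContMDiffOn I 𝓘(ℝ, ℝ) ∞ (fun x => G x i j) s) :
    ContMDiffOn I 𝓘(ℝ, ℝ) ∞ (fun x => (G x).det) s := by
  simp only [Matrix.det_apply, Units.smul_def, zsmul_eq_mul]
  exact contMDiffOn_finsetSum fun σ _ => contMDiffOn_const.mul
    (contMDiffOn_finsetProd fun i _ => hG _ _)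

theorem contMDiffOn_inv {s : Set M} {G : M → Matrix (Fin n) (Fin n) ℝ}
    (hG : ∀ i j, ContMDiffOn I 𝓘(ℝ, ℝ) ∞ (fun x => G x i j) s) (hdet : ∀ x ∈ s, (G x).det ≠ 0)
    (i j : Fin n) : ContMDiffOn I 𝓘(ℝ, ℝ) ∞ (fun x => (G x)⁻¹ i j) s := by
  simp only [Matrix.inv_def, Matrix.smul_apply, Ring.inverse_eq_inv', smul_eq_mul,
    Matrix.adjugate_apply]
  refine ((contMDiffOn_det hG).inv₀ hdet).mul (contMDiffOn_det fun a b => ?_)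
  simp only [Matrix.updateRow_apply]
  split_ifs
  · exact contMDiffOn_const
  · exact hG a b

theorem contMDiffOn_sqrt {s : Set M} {f : M → ℝ} (hf : ContMDiffOn I 𝓘(ℝ, ℝ) ∞ f s)
    (h0 : ∀ x ∈ s, f x ≠ 0) : ContMDiffOn I 𝓘(ℝ, ℝ) ∞ (fun x => √(f x)) s := fun x hx =>
  (Real.contDiffAt_sqrt (h0 x hx)).contMDiffAt.comp_contMDiffWithinAt x (hf x hx)

/-- The scalar product of a metric at a point, as a bilinear map. -/
def innerAt (g : Bundle.RiemannianMetric (fun x : M => TangentSpace I x)) (x : M) :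
    TangentSpace I x →ₗ[ℝ] TangentSpace I x →ₗ[ℝ] ℝ :=
  LinearMap.mk₂ ℝ (fun v w => g.inner x v w)
    (fun _ _ _ => by rw [map_add]; rfl) (fun _ _ _ => by rw [map_smul]; rfl)
    (fun _ _ _ => map_add _ _ _) (fun _ _ _ => map_smul _ _ _)

theorem innerAt_orthonormalTangentBasis
    (g : Bundle.RiemannianMetric (fun x : M => TangentSpace I x)) (x : M) (i j : Fin n) :
    innerAt g x (orthonormalTangentBasis g x i) (orthonormalTangentBasis g x j) =
      if i = j then 1 else 0 :=
  (exists_orthonormal_tangent_basis g x).choose_spec i j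

variable [IsManifold I ∞ M] {k l r : ℕ}

variable (I) in
/-- The differential at `x` of the inverse of the preferred chart at `x₀`. -/
def coordEquiv {x₀ x : M} (hx : x ∈ (chartAt H x₀).source) :
    EuclideanSpace ℝ (Fin n) ≃ₗ[ℝ] EuclideanSpace ℝ (Fin n) :=
  LinearEquiv.ofLinearMap (tangentCoordChange I x₀ x x : EuclideanSpace ℝ (Fin n) →L[ℝ] _).toLinearMap
    (tangentCoordChange I x x₀ x : EuclideanSpace ℝ (Fin n) →L[ℝ] _).toLinearMap
    (by
      ext1 v
      have h0 : x ∈ (extChartAt I x₀).source := by rwa [extChartAt_source]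
      have h1 : x ∈ (extChartAt I x).source := mem_extChartAt_source x
      exact (tangentCoordChange_comp ⟨⟨h1, h0⟩, h1⟩).trans (tangentCoordChange_self h1))
    (by
      ext1 v
      have h0 : x ∈ (extChartAt I x₀).source := by rwa [extChartAt_source]
      have h1 : x ∈ (extChartAt I x).source := mem_extChartAt_source x
      exact (tangentCoordChange_comp ⟨⟨h0, h1⟩, h0⟩).trans (tangentCoordChange_self h0))

variable (I) in
/-- The coordinate vectors of the preferred chart at `x₀`, as a basis of the tangent space. -/
def coordBasis {x₀ x : M} (hx : x ∈ (chartAt H x₀).source) :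
    Module.Basis (Fin n) ℝ (TangentSpace I x) :=
  ((EuclideanSpace.basisFun (Fin n) ℝ).toBasis.map (coordEquiv I hx) :
    Module.Basis (Fin n) ℝ (EuclideanSpace ℝ (Fin n)))

theorem coe_coordBasis {x₀ x : M} (hx : x ∈ (chartAt H x₀).source) :
    ⇑(coordBasis I hx) = coordFrame I x₀ x := by
  funext i
  change coordEquiv I hx ((EuclideanSpace.basisFun (Fin n) ℝ).toBasis i) = _
  rw [OrthonormalBasis.coe_toBasis, EuclideanSpace.basisFun_apply]
  rfl

theorem RawForm.wedge_mem (h : k + l = r) {θ : RawForm I M k} {η : RawForm I M l}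
    (hθ : θ ∈ Form I M k) (hη : η ∈ Form I M l) : θ.wedge h η ∈ Form I M r := by
  intro x₀ i
  have key : ∀ x : M, θ.wedge h η x (fun a => coordFrame I x₀ x (i a)) =
      ((k.factorial * l.factorial : ℕ) : ℝ)⁻¹ *
        ∑ π : Equiv.Perm (Fin r), ((Equiv.Perm.sign π : ℤ) : ℝ) *
          (θ x (fun a => coordFrame I x₀ x (i (π (splitFin h (Sum.inl a))))) *
            η x (fun a => coordFrame I x₀ x (i (π (splitFin h (Sum.inr a)))))) := by
    intro x
    rw [eq_inv_mul_iff_mul_eq₀ (factorial_mul_ne_zero k l)]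
    exact factorial_mul_wedge_apply h (θ x) (η x) _
  simp only [key]
  refine contMDiffOn_const.mul (contMDiffOn_finsetSum fun π _ => contMDiffOn_const.mul ?_)
  exact (hθ x₀ _).mul (hη x₀ _)

/-- A metric is smooth if its coefficients in each chart are. -/
def IsSmoothMetric (g : Bundle.RiemannianMetric (fun x : M => TangentSpace I x)) : Prop :=
  ∀ (x₀ : M) (i j : Fin n), ContMDiffOn I 𝓘(ℝ, ℝ) ∞
    (fun x => g.inner x (coordFrame I x₀ x i) (coordFrame I x₀ x j)) (chartAt H x₀).source

/-- Continuity of the orientation makes this sign locally constant on the chart domain. -/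
theorem ManifoldOrientation.contMDiffOn_frameSign (o : ManifoldOrientation I M) (x₀ : M) :
    ContMDiffOn I 𝓘(ℝ, ℝ) ∞ (fun x => frameSign (o.toFun x) (coordFrame I x₀ x))
      (chartAt H x₀).source := by
  intro x hx
  refine ContMDiffAt.contMDiffWithinAt ?_
  rcases o.continuous' x₀ x hx with h | h
  · refine (contMDiffAt_const (c := (1 : ℝ))).congr_of_eventuallyEq ?_
    filter_upwards [h] with y hy
    simp [frameSign, hy]
  · refine (contMDiffAt_const (c := (-1 : ℝ))).congr_of_eventuallyEq ?_
    filter_upwards [h] with y hy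
    simp [frameSign, hy]

/-- The orthonormal bases defining the star are chosen point by point, with no continuity. In the
coordinate frame they disappear: the coefficients of `⋆θ` are built from those of `θ`, the inverse
Gram matrix, the root of its nonvanishing determinant, and a locally constant sign. -/
theorem hodgeStar_mem (h : k + l = n) {g : Bundle.RiemannianMetric (fun x : M => TangentSpace I x)}
    (hg : IsSmoothMetric g) (o : ManifoldOrientation I M) {θ : RawForm I M k}
    (hθ : θ ∈ Form I M k) : hodgeStar h g o.toFun θ ∈ Form I M l := by
  intro x₀ J
  let G : M → Matrix (Fin n) (Fin n) ℝ := fun x => gramMatrix (innerAt g x) (coordFrame I x₀ x)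
  have hG : ∀ i j, ContMDiffOn I 𝓘(ℝ, ℝ) ∞ (fun x => G x i j) (chartAt H x₀).source :=
    fun i j => hg x₀ i j
  have hdet : ∀ x ∈ (chartAt H x₀).source, (G x).det ≠ 0 := by
    intro x hx
    simp only [G, ← coe_coordBasis hx]
    rw [det_gramMatrix (innerAt_orthonormalTangentBasis g x)]
    exact pow_ne_zero 2 (Module.Basis.isUnit_det _ _).ne_zero
  have key : ∀ x ∈ (chartAt H x₀).source,
      hodgeStar h g o.toFun θ x (fun a => coordFrame I x₀ x (J a)) =
      (k.factorial : ℝ)⁻¹ * ∑ r : Fin k → Fin n, ∑ s : Fin k → Fin n,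
        (∏ a, (G x)⁻¹ (r a) (s a)) * (θ x (fun a => coordFrame I x₀ x (r a)) *
          (frameSign (o.toFun x) (coordFrame I x₀ x) * √(G x).det *
            ((1 : Matrix (Fin n) (Fin n) ℝ).submatrix id
              (fun i => Sum.elim s J ((splitFin h).symm i))).det)) := by
    intro x hx
    simp only [G, ← coe_coordBasis hx]
    exact hodgeInBasis_apply_basis h (innerAt_orthonormalTangentBasis g x) (o.toFun x) (θ x)
      (coordBasis I hx) J
  refine ContMDiffOn.congr ?_ key
  refine contMDiffOn_const.mul (contMDiffOn_finsetSum fun r _ => contMDiffOn_finsetSum fun s _ => ?_)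
  refine (contMDiffOn_finsetProd fun a _ => contMDiffOn_inv hG hdet _ _).mul ?_
  refine (hθ x₀ r).mul (((o.contMDiffOn_frameSign x₀).mul ?_).mul contMDiffOn_const)
  exact contMDiffOn_sqrt (contMDiffOn_det hG) hdet

end SmoothForms

/-! ### The Hodge star as a bijection between spaces of smooth forms. -/

section HodgeStar

variable {n : ℕ} {H : Type*} [TopologicalSpace H]
  {I : ModelWithCorners ℝ (EuclideanSpace ℝ (Fin n)) H}
  {M : Type*} [TopologicalSpace M] [ChartedSpace H M] [IsManifold I ∞ M] {k l : ℕ}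
  {g : Bundle.RiemannianMetric (fun x : M => TangentSpace I x)}

/-- The Hodge star on smooth forms. -/
def formStar (hg : IsSmoothMetric g) (o : ManifoldOrientation I M) (h : k + l = n) :
    Form I M k →ₗ[ℝ] Form I M l :=
  (hodgeStar h g o.toFun).restrict fun _ hθ => hodgeStar_mem h hg o hθ

variable (hg : IsSmoothMetric g) (o : ManifoldOrientation I M)

theorem formStar_formStar (h : k + l = n) (h' : l + k = n) (θ : Form I M k) :
    formStar hg o h' (formStar hg o h θ) = blockSign h h' • θ :=
  Subtype.ext (funext fun x => hodgeInBasis_hodgeInBasis h h' (orthonormalTangentBasis g x)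
    (o.toFun x) (θ.1 x))

theorem formStar_surjective (h : k + l = n) : Function.Surjective (formStar hg o h) := fun η => by
  have h' : l + k = n := by omega
  refine ⟨blockSign h' h • formStar hg o h' η, ?_⟩
  rw [map_smul, formStar_formStar, smul_smul, blockSign_mul_self, one_smul]

end HodgeStar

/-! ### Integration of smooth forms and the `L²` inner product. -/

section Integration

open MeasureTheory

variable {n : ℕ} {H : Type*} [TopologicalSpace H]
  {I : ModelWithCorners ℝ (EuclideanSpace ℝ (Fin n)) H}
  {M : Type*} [TopologicalSpace M] [ChartedSpace H M]

theorem measurableSet_extChartAt_target (x₀ : M) : MeasurableSet (extChartAt I x₀).target := by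
  rw [extChartAt_target]
  exact ((chartAt H x₀).open_target.preimage I.continuous_symm).measurableSet.inter
    I.isClosed_range.measurableSet

variable [IsManifold I ∞ M] [T2Space M] [CompactSpace M] {k l : ℕ}

theorem tsupport_chartPartition_subset (x₀ : M) :
    tsupport (chartPartition I M x₀) ⊆ (chartAt H x₀).source :=
  (SmoothPartitionOfUnity.exists_isSubordinate_chartAt_source I M).choose_spec x₀

/-- The function integrated in the chart at `x₀` in the definition of the integral of a form. -/
def chartIntegrand (o : ManifoldOrientation I M) (θ : RawForm I M n) (x₀ x : M) : ℝ :=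
  chartPartition I M x₀ x * frameSign (o.toFun x) (coordFrame I x₀ x) * θ x (coordFrame I x₀ x)

theorem formIntegral_eq_finsum (o : ManifoldOrientation I M) (θ : RawForm I M n) :
    formIntegral o.toFun θ = ∑ᶠ x₀ : M, ∫ u in (extChartAt I x₀).target,
      chartIntegrand o θ x₀ ((extChartAt I x₀).symm u) := rfl

/-- Only finitely many charts contribute to the integral. -/
theorem finite_support_chartPartition :
    {x₀ : M | (Function.support (chartPartition I M x₀)).Nonempty}.Finite :=
  (chartPartition I M).locallyFinite.finite_nonempty_of_compact

variable (I M) in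
/-- The finite set of the charts which contribute to the integral. -/
def chartFinset : Finset M := (finite_support_chartPartition (I := I) (M := M)).toFinset

theorem formIntegral_eq_sum (o : ManifoldOrientation I M) (θ : RawForm I M n) :
    formIntegral o.toFun θ = ∑ x₀ ∈ chartFinset I M, ∫ u in (extChartAt I x₀).target,
      chartIntegrand o θ x₀ ((extChartAt I x₀).symm u) := by
  rw [formIntegral_eq_finsum]
  refine finsum_eq_sum_of_support_subset _ (fun x₀ hx₀ => ?_)
  rw [chartFinset, Finite.coe_toFinset]
  by_contra hne
  apply hx₀
  have h0 : ∀ x, chartPartition I M x₀ x = 0 := fun x => by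
    by_contra hx
    exact hne ⟨x, hx⟩
  simp [chartIntegrand, h0]

theorem continuousOn_chartIntegrand (o : ManifoldOrientation I M) {θ : RawForm I M n}
    (hθ : θ ∈ Form I M n) (x₀ : M) :
    ContinuousOn (chartIntegrand o θ x₀) (chartAt H x₀).source :=
  (((chartPartition I M x₀).contMDiff.continuous.continuousOn).mul
    (o.contMDiffOn_frameSign x₀).continuousOn).mul (hθ x₀ id).continuousOn

theorem continuousOn_chartIntegrand_symm (o : ManifoldOrientation I M) {θ : RawForm I M n}
    (hθ : θ ∈ Form I M n) (x₀ : M) :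
    ContinuousOn (fun u => chartIntegrand o θ x₀ ((extChartAt I x₀).symm u))
      (extChartAt I x₀).target :=
  (continuousOn_chartIntegrand o hθ x₀).comp (continuousOn_extChartAt_symm x₀) fun u hu => by
    rw [← extChartAt_source (I := I)]
    exact (extChartAt I x₀).map_target hu

/-- The chart target may be unbounded and the form may blow up towards its edge, but the partition
function is supported in a compact subset of the chart domain; the integrand is continuous on the
image of that set and zero elsewhere. -/
theorem integrableOn_chartIntegrand (o : ManifoldOrientation I M) {θ : RawForm I M n}
    (hθ : θ ∈ Form I M n) (x₀ : M) :
    IntegrableOn (fun u => chartIntegrand o θ x₀ ((extChartAt I x₀).symm u))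
      (extChartAt I x₀).target := by
  set K := extChartAt I x₀ '' tsupport (chartPartition I M x₀) with hK
  have hsub : tsupport (chartPartition I M x₀) ⊆ (extChartAt I x₀).source := by
    rw [extChartAt_source]
    exact tsupport_chartPartition_subset x₀
  have hKT : K ⊆ (extChartAt I x₀).target := by
    rintro _ ⟨x, hx, rfl⟩
    exact (extChartAt I x₀).map_source (hsub hx)
  have hKc : IsCompact K :=
    ((isClosed_tsupport _).isCompact).image_of_continuousOn
      ((continuousOn_extChartAt x₀).mono hsub)
  refine IntegrableOn.of_forall_sdiff_eq_zero
    (((continuousOn_chartIntegrand_symm o hθ x₀).mono hKT).integrableOn_compact hKc)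
    (measurableSet_extChartAt_target x₀) (fun u hu => ?_)
  have h0 : chartPartition I M x₀ ((extChartAt I x₀).symm u) = 0 := by
    by_contra hne
    exact hu.2 ⟨_, subset_tsupport _ hne, (extChartAt I x₀).right_inv hu.1⟩
  rw [chartIntegrand, h0, zero_mul, zero_mul]

/-- The integral of smooth forms of top degree over a compact oriented manifold. -/
def integralMap (o : ManifoldOrientation I M) : Form I M n →ₗ[ℝ] ℝ where
  toFun θ := formIntegral o.toFun θ.1
  map_add' θ η := by
    rw [formIntegral_eq_sum, formIntegral_eq_sum, formIntegral_eq_sum, ← Finset.sum_add_distrib]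
    refine Finset.sum_congr rfl fun x₀ _ => ?_
    rw [← integral_add (integrableOn_chartIntegrand o θ.2 x₀)
      (integrableOn_chartIntegrand o η.2 x₀)]
    exact integral_congr_ae (.of_forall fun u => mul_add _ _ _)
  map_smul' c θ := by
    rw [formIntegral_eq_sum, formIntegral_eq_sum, RingHom.id_apply, smul_eq_mul, Finset.mul_sum]
    refine Finset.sum_congr rfl fun x₀ _ => ?_
    rw [← integral_const_mul]
    exact integral_congr_ae (.of_forall fun u => mul_left_comm _ _ _)

/-- A vanishing sum of nonnegative integrals has vanishing terms, and a continuous nonnegative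
integrand with zero integral is zero. At a given point, a chart whose partition function is positive
there yields the value of the form. -/
theorem eq_zero_of_formIntegral_eq_zero (o : ManifoldOrientation I M) {θ : RawForm I M n}
    (hθ : θ ∈ Form I M n)
    (hnonneg : ∀ x₀ : M, ∀ x ∈ (chartAt H x₀).source,
      0 ≤ frameSign (o.toFun x) (coordFrame I x₀ x) * θ x (coordFrame I x₀ x))
    (h0 : formIntegral o.toFun θ = 0) : ∀ x, θ x = 0 := by
  have hsource : ∀ x₀ : M, ∀ u ∈ (extChartAt I x₀).target,
      (extChartAt I x₀).symm u ∈ (chartAt H x₀).source := fun x₀ u hu => by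
    rw [← extChartAt_source (I := I)]
    exact (extChartAt I x₀).map_target hu
  have hpos : ∀ x₀ : M, ∀ u ∈ (extChartAt I x₀).target,
      0 ≤ chartIntegrand o θ x₀ ((extChartAt I x₀).symm u) := fun x₀ u hu => by
    rw [chartIntegrand, mul_assoc]
    exact mul_nonneg ((chartPartition I M).nonneg x₀ _) (hnonneg x₀ _ (hsource x₀ u hu))
  rw [formIntegral_eq_sum, Finset.sum_eq_zero_iff_of_nonneg (fun x₀ _ =>
    setIntegral_nonneg (measurableSet_extChartAt_target x₀) (hpos x₀))] at h0
  intro x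
  obtain ⟨x₀, hx₀⟩ := (chartPartition I M).exists_pos_of_mem (mem_univ x)
  have hx : x ∈ (chartAt H x₀).source :=
    tsupport_chartPartition_subset x₀ (subset_tsupport _ hx₀.ne')
  have hx' : x ∈ (extChartAt I x₀).source := by rwa [extChartAt_source]
  have hmem : x₀ ∈ chartFinset I M := by
    rw [chartFinset, Finite.mem_toFinset]
    exact ⟨x, hx₀.ne'⟩
  have hint := h0 x₀ hmem
  rw [setIntegral_eq_zero_iff_of_nonneg_ae
    ((ae_restrict_iff' (measurableSet_extChartAt_target x₀)).2 (.of_forall (hpos x₀)))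
    (integrableOn_chartIntegrand o hθ x₀)] at hint
  -- Almost everywhere equality gives equality at boundary points too, because the chart target lies
  -- in the closure of its interior.
  have heq : chartIntegrand o θ x₀ ((extChartAt I x₀).symm (extChartAt I x₀ x)) = 0 :=
    Measure.eqOn_of_ae_eq hint (continuousOn_chartIntegrand_symm o hθ x₀)
    continuousOn_const extChartAt_target_subset_closure_interior
    ((extChartAt I x₀).map_source hx')
  rw [(extChartAt I x₀).left_inv hx', chartIntegrand] at heq
  have hsign : frameSign (o.toFun x) (coordFrame I x₀ x) ≠ 0 := fun hz => by
    simpa [hz] using frameSign_mul_self (o.toFun x) (coordFrame I x₀ x)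
  have hval : θ x (coordFrame I x₀ x) = 0 :=
    (mul_eq_zero.1 heq).resolve_left (mul_ne_zero hx₀.ne' hsign)
  rw [← coe_coordBasis hx] at hval
  exact ((θ x).map_basis_eq_zero_iff (coordBasis I hx)).1 hval

/-- The pairing `∫ θ ∧ η` of smooth forms of complementary degrees. -/
def wedgeIntegral (o : ManifoldOrientation I M) (h : k + l = n) :
    Form I M k →ₗ[ℝ] Form I M l →ₗ[ℝ] ℝ :=
  LinearMap.mk₂ ℝ (fun θ η => integralMap o ⟨θ.1.wedge h η.1, RawForm.wedge_mem h θ.2 η.2⟩)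
    (fun θ θ' η => by
      rw [← map_add]
      congr 1
      exact Subtype.ext (funext fun x => wedge_add_left h (θ.1 x) (θ'.1 x) (η.1 x)))
    (fun c θ η => by
      rw [← map_smul]
      congr 1
      exact Subtype.ext (funext fun x => wedge_smul_left h c (θ.1 x) (η.1 x)))
    (fun θ η η' => by
      rw [← map_add]
      congr 1
      exact Subtype.ext (funext fun x => wedge_add_right h (θ.1 x) (η.1 x) (η'.1 x)))
    (fun c θ η => by
      rw [← map_smul]
      congr 1
      exact Subtype.ext (funext fun x => wedge_smul_right h c (θ.1 x) (η.1 x)))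

variable {g : Bundle.RiemannianMetric (fun x : M => TangentSpace I x)}

variable (hg : IsSmoothMetric g) (o : ManifoldOrientation I M)

theorem wedgeIntegral_comm (h : k + l = n) (h' : l + k = n) (θ : Form I M k) (η : Form I M l) :
    wedgeIntegral o h' η θ = blockSign h h' * wedgeIntegral o h θ η := by
  rw [← smul_eq_mul]
  change integralMap o _ = _ • integralMap o _
  rw [← map_smul]
  congr 1
  exact Subtype.ext (funext fun x => wedge_comm h h' (θ.1 x) (η.1 x))

/-- The sign of `⋆⋆` and the sign from exchanging the factors are both `blockSign h h'`, so they
cancel. This is why no sign depending on the degrees appears in the pairing. -/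
theorem wedgeIntegral_formStar_formStar (h : k + l = n) (h' : l + k = n) (e : Form I M k)
    (f : Form I M l) :
    wedgeIntegral o h' f (formStar hg o h' (formStar hg o h e)) = wedgeIntegral o h e f := by
  rw [formStar_formStar, map_smul, wedgeIntegral_comm o h h', smul_eq_mul, ← mul_assoc,
    blockSign_mul_self, one_mul]

theorem wedgeIntegral_formStar_comm (h : k + l = n) (θ η : Form I M k) :
    wedgeIntegral o h θ (formStar hg o h η) = wedgeIntegral o h η (formStar hg o h θ) := by
  change integralMap o _ = integralMap o _
  congr 1
  exact Subtype.ext (funext fun x => wedge_hodgeInBasis_comm h (orthonormalTangentBasis g x)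
    (o.toFun x) (θ.1 x) (η.1 x))

/-- The `L²` inner product of forms is definite. -/
theorem eq_zero_of_wedgeIntegral_formStar_self (h : k + l = n) {θ : Form I M k}
    (hθ : wedgeIntegral o h θ (formStar hg o h θ) = 0) : θ = 0 := by
  have hx₀ : ∀ x₀ : M, ∀ x ∈ (chartAt H x₀).source,
      ∃ d : ℝ, 0 < d ∧ frameSign (o.toFun x) (coordFrame I x₀ x) *
        (θ.1.wedge h (formStar hg o h θ).1 : RawForm I M n) x (coordFrame I x₀ x) =
        basisInner h (orthonormalTangentBasis g x) (θ.1 x) (θ.1 x) * d := fun x₀ x hx => by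
    rw [← coe_coordBasis hx]
    exact ⟨_, abs_pos.2 (Module.Basis.isUnit_det _ _).ne_zero,
      frameSign_mul_wedge_hodgeInBasis h (orthonormalTangentBasis g x) (coordBasis I hx)
        (o.toFun x) (θ.1 x) (θ.1 x)⟩
  have hzero := eq_zero_of_formIntegral_eq_zero o
    (RawForm.wedge_mem h θ.2 (formStar hg o h θ).2) (fun x₀ x hx => by
      obtain ⟨d, hd, heq⟩ := hx₀ x₀ x hx
      rw [heq]
      exact mul_nonneg (basisInner_self_nonneg _ _ _) hd.le) hθ
  refine Subtype.ext (funext fun x => ?_)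
  obtain ⟨d, hd, heq⟩ := hx₀ x x (mem_chart_source H x)
  rw [hzero x, AlternatingMap.zero_apply, mul_zero, eq_comm, mul_eq_zero] at heq
  exact eq_zero_of_basisInner_self h (orthonormalTangentBasis g x) (heq.resolve_right hd.ne')

/-- Nondegeneracy of the smooth duality: for `η = ⋆θ`, testing against `θ` itself gives its squared
`L²` norm. -/
theorem eq_zero_of_forall_wedgeIntegral (h : k + l = n) {η : Form I M l}
    (hη : ∀ θ : Form I M k, wedgeIntegral o h θ η = 0) (hg : IsSmoothMetric g) : η = 0 := by
  obtain ⟨θ, rfl⟩ := formStar_surjective hg o h η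
  rw [eq_zero_of_wedgeIntegral_formStar_self hg o h (hη θ), map_zero]

end Integration

/-- The components of a tangent vector in the preferred chart at its base point. -/
def tangentCoord {n : ℕ} {H : Type*} [TopologicalSpace H]
    {I : ModelWithCorners ℝ (EuclideanSpace ℝ (Fin n)) H} {M : Type*} [TopologicalSpace M]
    [ChartedSpace H M] {x : M} (v : TangentSpace I x) (i : Fin n) : ℝ :=
  letI w : EuclideanSpace ℝ (Fin n) := v
  w i

/-! ### Smooth bundle metrics have smooth coefficients in charts. -/

section SmoothMetric

variable {n : ℕ} {H : Type*} [TopologicalSpace H]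
  {I : ModelWithCorners ℝ (EuclideanSpace ℝ (Fin n)) H}
  {M : Type*} [TopologicalSpace M] [ChartedSpace H M] [IsManifold I ∞ M]

/-- The coordinate fields are the local frame of the tangent bundle given by its preferred
trivialization, hence smooth sections. -/
theorem contMDiffOn_coordFrame (x₀ : M) (i : Fin n) :
    ContMDiffOn I (I.prod 𝓘(ℝ, EuclideanSpace ℝ (Fin n))) ∞
      (fun x => Bundle.TotalSpace.mk' (EuclideanSpace ℝ (Fin n)) (E := fun x : M => TangentSpace I x)
        x (coordFrame I x₀ x i)) (chartAt H x₀).source := by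
  have : IsManifold I (∞ + 1) M := by simpa
  have h := (trivializationAt (EuclideanSpace ℝ (Fin n)) (TangentSpace I : M → Type _)
    x₀).contMDiffOn_localFrame_baseSet (I := I) ∞ (EuclideanSpace.basisFun (Fin n) ℝ).toBasis i
  rw [TangentBundle.trivializationAt_baseSet] at h
  refine h.congr fun x hx => ?_
  have hx' : x ∈ (trivializationAt (EuclideanSpace ℝ (Fin n)) (TangentSpace I : M → Type _)
    x₀).baseSet := by rwa [TangentBundle.trivializationAt_baseSet]
  have hc := TangentBundle.symmL_trivializationAt_eq_core (I := I) hx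
  rw [Bundle.Trivialization.localFrame_apply_of_mem_baseSet _ _ hx']
  congr 1
  have hb : (EuclideanSpace.basisFun (Fin n) ℝ).toBasis i = EuclideanSpace.single i 1 := by simp
  change _ = (trivializationAt (EuclideanSpace ℝ (Fin n)) (TangentSpace I : M → Type _)
    x₀).symm x ((EuclideanSpace.basisFun (Fin n) ℝ).toBasis i)
  rw [hb, ← Bundle.Trivialization.symmL_apply (R := ℝ) _ hx']
  exact (congrArg (fun L => L (EuclideanSpace.single i 1)) hc).symm

theorem isSmoothMetric (g : Bundle.ContMDiffRiemannianMetric I ∞ (EuclideanSpace ℝ (Fin n))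
    (fun x : M => TangentSpace I x)) : IsSmoothMetric g.toRiemannianMetric := by
  intro x₀ i j x hx
  have h : ContMDiffWithinAt I (I.prod 𝓘(ℝ, ℝ)) ∞
      (fun y => Bundle.TotalSpace.mk' ℝ (E := Bundle.Trivial M ℝ) y
        (g.inner y (coordFrame I x₀ y i) (coordFrame I x₀ y j))) (chartAt H x₀).source x := by
    apply ContMDiffWithinAt.clm_bundle_apply₂ (F₁ := EuclideanSpace ℝ (Fin n))
      (F₂ := EuclideanSpace ℝ (Fin n))
    · exact g.contMDiff.contMDiffAt.contMDiffWithinAt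
    · exact contMDiffOn_coordFrame x₀ i x hx
    · exact contMDiffOn_coordFrame x₀ j x hx
  simp only [Bundle.contMDiffWithinAt_totalSpace] at h
  exact h.2

end SmoothMetric

/-! ### Induced metric and orientation on the boundary. -/

section BoundaryGeometry

variable {m : ℕ} {Z : Type*} [TopologicalSpace Z] [ChartedSpace (EuclideanHalfSpace (m + 1)) Z]
  [IsManifold (𝓡∂ (m + 1)) ∞ Z]

theorem contMDiff_boundary_val :
    ContMDiff (𝓡 m) (𝓡∂ (m + 1)) ∞ (Subtype.val : (𝓡∂ (m + 1)).boundary Z → Z) := by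
  intro y
  rw [contMDiffAt_iff]
  refine ⟨continuous_subtype_val.continuousAt, ?_⟩
  refine ContDiffAt.contDiffWithinAt ?_
  refine (consZero m).contDiff.contDiffAt.congr_of_eventuallyEq
    (Filter.eventually_of_mem (extChartAt_target_mem_nhds y) fun v hv => ?_)
  have hv' : toHalfSpace m v ∈ (chartAt (EuclideanHalfSpace (m + 1)) y.1).target := by
    simpa [extChartAt] using! hv
  change ((chartAt (EuclideanHalfSpace (m + 1)) y.1)
    ((boundaryChart (chartAt (EuclideanHalfSpace (m + 1)) y.1)
      (chart_mem_atlas _ y.1) y).symm v).1).val = _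
  rw [boundaryChart_symm_apply hv', OpenPartialHomeomorph.right_inv _ hv']
  rfl

theorem extChartAt_boundary {y₀ y : (𝓡∂ (m + 1)).boundary Z}
    (hy : y.1 ∈ (chartAt (EuclideanHalfSpace (m + 1)) y₀.1).source) :
    consZero m (extChartAt (𝓡 m) y₀ y) = extChartAt (𝓡∂ (m + 1)) y₀.1 y.1 :=
  consZero_dropZero ((mem_boundary_iff (chart_mem_atlas _ y₀.1) hy).1 y.2)

theorem extChartAt_boundary_symm {y₀ : (𝓡∂ (m + 1)).boundary Z} {v : EuclideanSpace ℝ (Fin m)}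
    (hv : v ∈ (extChartAt (𝓡 m) y₀).target) :
    (extChartAt (𝓡∂ (m + 1)) y₀.1).symm (consZero m v) = ((extChartAt (𝓡 m) y₀).symm v).1 := by
  have hv' : toHalfSpace m v ∈ (chartAt (EuclideanHalfSpace (m + 1)) y₀.1).target := by
    simpa [extChartAt] using! hv
  refine Eq.trans ?_ (boundaryChart_symm_apply (he := chart_mem_atlas _ y₀.1) (y := y₀) hv').symm
  change (chartAt (EuclideanHalfSpace (m + 1)) y₀.1).symm ((𝓡∂ (m + 1)).symm (consZero m v)) = _
  congr 1
  exact (𝓡∂ (m + 1)).left_inv (toHalfSpace m v)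

/-- On vectors tangent to the boundary, the coordinate changes of the manifold are those of the
boundary. -/
theorem tangentCoordChange_consZero {y₀ y : (𝓡∂ (m + 1)).boundary Z}
    (hy : y.1 ∈ (chartAt (EuclideanHalfSpace (m + 1)) y₀.1).source)
    (v : EuclideanSpace ℝ (Fin m)) :
    tangentCoordChange (𝓡∂ (m + 1)) y₀.1 y.1 y.1 (consZero m v) =
      consZero m (tangentCoordChange (𝓡 m) y₀ y y v) := by
  have hsZ : y.1 ∈ (extChartAt (𝓡∂ (m + 1)) y₀.1).source ∩
      (extChartAt (𝓡∂ (m + 1)) y.1).source :=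
    ⟨by rwa [extChartAt_source], mem_extChartAt_source _⟩
  have hy' : y ∈ (extChartAt (𝓡 m) y₀).source := by rw [extChartAt_source]; exact hy
  have h1 := hasFDerivWithinAt_tangentCoordChange hsZ
  rw [← extChartAt_boundary hy] at h1
  -- On `Z` the derivative exists only within the half-space. Since `consZero` maps all of `ℝᵐ` into
  -- it, the composite has a full derivative, which is unique.
  have h1' : HasFDerivAt (extChartAt (𝓡∂ (m + 1)) y.1 ∘ (extChartAt (𝓡∂ (m + 1)) y₀.1).symm ∘
      consZero m) (tangentCoordChange (𝓡∂ (m + 1)) y₀.1 y.1 y.1 ∘L consZero m)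
      (extChartAt (𝓡 m) y₀ y) := by
    rw [← hasFDerivWithinAt_univ]
    exact h1.comp _ (consZero m).hasFDerivAt.hasFDerivWithinAt
      fun w _ => ⟨toHalfSpace m w, rfl⟩
  have h2 := hasFDerivWithinAt_tangentCoordChange (I := 𝓡 m) (x := y₀) (y := y) (z := y)
    ⟨hy', mem_extChartAt_source _⟩
  rw [show range (𝓡 m) = univ by simp, hasFDerivWithinAt_univ] at h2
  have h2' := (consZero m).hasFDerivAt.comp _ h2
  have hev : (extChartAt (𝓡∂ (m + 1)) y.1 ∘ (extChartAt (𝓡∂ (m + 1)) y₀.1).symm ∘ consZero m)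
      =ᶠ[𝓝 (extChartAt (𝓡 m) y₀ y)]
      (consZero m ∘ extChartAt (𝓡 m) y ∘ (extChartAt (𝓡 m) y₀).symm) := by
    have hcont := continuousAt_extChartAt_symm' (I := 𝓡 m) hy'
    have hnhds : (chartAt (EuclideanSpace ℝ (Fin m)) y).source ∈
        𝓝 ((extChartAt (𝓡 m) y₀).symm (extChartAt (𝓡 m) y₀ y)) := by
      rw [(extChartAt (𝓡 m) y₀).left_inv hy']
      exact chart_source_mem_nhds _ y
    filter_upwards [hcont.preimage_mem_nhds hnhds, extChartAt_target_mem_nhds' ((extChartAt (𝓡 m) y₀).map_source hy')] with w hw hw'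
    simp only [Function.comp_apply]
    rw [extChartAt_boundary_symm hw', extChartAt_boundary (y₀ := y) hw]
  have := (h1'.congr_of_eventuallyEq hev.symm).unique h2'
  exact congrArg (fun L => L v) this

theorem boundaryDiff_coordFrame {y₀ y : (𝓡∂ (m + 1)).boundary Z}
    (hy : y.1 ∈ (chartAt (EuclideanHalfSpace (m + 1)) y₀.1).source) (i : Fin m) :
    boundaryDiff y (coordFrame (𝓡 m) y₀ y i) = coordFrame (𝓡∂ (m + 1)) y₀.1 y.1 i.succ := by
  have h : boundaryDiff y = consZero m := mfderiv_boundary_val y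
  rw [h]
  refine (tangentCoordChange_consZero hy (EuclideanSpace.single i 1)).symm.trans ?_
  change _ = tangentCoordChange (𝓡∂ (m + 1)) y₀.1 y.1 y.1 (EuclideanSpace.single i.succ 1)
  congr 1
  ext j
  refine Fin.cases ?_ (fun j => ?_) j <;> simp

/-- The inclusion sends coordinate fields of `∂Z` to those of `Z` with indices shifted by one, so
the coefficients of the induced metric are restrictions of coefficients of `g`. -/
theorem isSmoothMetric_boundaryMetric
    {g : Bundle.RiemannianMetric (fun x : Z => TangentSpace (𝓡∂ (m + 1)) x)}
    (hg : IsSmoothMetric g) : IsSmoothMetric (boundaryMetric g) := by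
  intro y₀ i j
  have h := (hg y₀.1 i.succ j.succ).comp (contMDiff_boundary_val (Z := Z)).contMDiffOn
    (s := (chartAt (EuclideanSpace ℝ (Fin m)) y₀).source) (fun y hy => hy)
  refine h.congr fun y hy => ?_
  change g.inner y.1 (boundaryDiff y (coordFrame (𝓡 m) y₀ y i))
    (boundaryDiff y (coordFrame (𝓡 m) y₀ y j)) = _
  rw [boundaryDiff_coordFrame hy, boundaryDiff_coordFrame hy]
  rfl

/-- The coordinate vector field transversal to the boundary points inward. -/
theorem coordFrame_zero_nonneg {y₀ y : (𝓡∂ (m + 1)).boundary Z}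
    (hy : y.1 ∈ (chartAt (EuclideanHalfSpace (m + 1)) y₀.1).source) :
    0 ≤ tangentCoord (coordFrame (𝓡∂ (m + 1)) y₀.1 y.1 0) 0 := by
  have hsZ : y.1 ∈ (extChartAt (𝓡∂ (m + 1)) y₀.1).source ∩
      (extChartAt (𝓡∂ (m + 1)) y.1).source :=
    ⟨by rwa [extChartAt_source], mem_extChartAt_source _⟩
  have h1 := hasFDerivWithinAt_tangentCoordChange hsZ
  have h2 := (EuclideanSpace.proj (𝕜 := ℝ) (0 : Fin (m + 1))).hasFDerivAt.comp_hasFDerivWithinAt _ h1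
  have hzero : (extChartAt (𝓡∂ (m + 1)) y.1 y.1) 0 = 0 := by
    rw [← extChartAt_boundary (mem_chart_source _ _)]
    exact consZero_zero _
  -- Chart values always lie in the half-space, so the coordinate of index `0` is nonnegative
  -- everywhere, and it vanishes at `y`. Its derivative in any direction pointing into the
  -- half-space is therefore nonnegative.
  have hmin : IsLocalMinOn (EuclideanSpace.proj (𝕜 := ℝ) (0 : Fin (m + 1)) ∘
      extChartAt (𝓡∂ (m + 1)) y.1 ∘ (extChartAt (𝓡∂ (m + 1)) y₀.1).symm)
      (range (𝓡∂ (m + 1))) (extChartAt (𝓡∂ (m + 1)) y₀.1 y.1) := by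
    refine Filter.Eventually.of_forall fun w => ?_
    simp only [Function.comp_apply, (extChartAt (𝓡∂ (m + 1)) y₀.1).left_inv hsZ.1]
    refine hzero.le.trans ?_
    exact (chartAt (EuclideanHalfSpace (m + 1)) y.1
      ((extChartAt (𝓡∂ (m + 1)) y₀.1).symm w)).2
  refine hmin.hasFDerivWithinAt_nonneg h2 (mem_posTangentConeAt_of_segment_subset ?_)
  rintro _ ⟨a, b, ha, hb, hab, rfl⟩
  rw [range_modelWithCornersEuclideanHalfSpace]
  have hp : 0 ≤ (extChartAt (𝓡∂ (m + 1)) y₀.1 y.1) 0 :=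
    (chartAt (EuclideanHalfSpace (m + 1)) y₀.1 y.1).2
  have : 0 ≤ a * (extChartAt (𝓡∂ (m + 1)) y₀.1 y.1) 0 +
    b * ((extChartAt (𝓡∂ (m + 1)) y₀.1 y.1) 0 + 1) := by positivity
  simpa [PiLp.single_apply, mul_add] using! this

/-- The outward vector followed by the standard basis of the boundary, as a basis. -/
def outwardBasis (y : (𝓡∂ (m + 1)).boundary Z) :
    Module.Basis (Fin (m + 1)) ℝ (TangentSpace (𝓡∂ (m + 1)) y.1) :=
  ((EuclideanSpace.basisFun (Fin (m + 1)) ℝ).toBasis.unitsSMul (Fin.cons (-1) fun _ => 1) :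
    Module.Basis (Fin (m + 1)) ℝ (EuclideanSpace ℝ (Fin (m + 1))))

theorem coe_outwardBasis (y : (𝓡∂ (m + 1)).boundary Z) :
    ⇑(outwardBasis y) =
      Fin.cons (outwardVector y.1) (fun i => boundaryDiff y (boundaryBasis y i)) := by
  have h : boundaryDiff y = consZero m := mfderiv_boundary_val y
  funext i
  refine (Module.Basis.unitsSMul_apply (v := (EuclideanSpace.basisFun (Fin (m + 1)) ℝ).toBasis)
    (w := Fin.cons (-1) fun _ => 1) i).trans ?_
  refine Fin.cases ?_ (fun i => ?_) i
  · simp only [Fin.cons_zero, OrthonormalBasis.coe_toBasis, EuclideanSpace.basisFun_apply]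
    rw [Units.smul_def, Units.val_neg, Units.val_one, neg_one_smul]
    rfl
  · simp only [Fin.cons_succ, OrthonormalBasis.coe_toBasis, EuclideanSpace.basisFun_apply, one_smul]
    rw [h]
    change _ = consZero m ((EuclideanSpace.basisFun (Fin m) ℝ).toBasis i)
    ext j
    refine Fin.cases ?_ (fun j => ?_) j <;> simp [PiLp.single_apply]

/-- The row of index `0` has a single nonzero entry, that of `w 0`; expansion along it leaves the
boundary determinant. The minus sign comes from the outward vector. -/
theorem det_of_succ_eq_consZero {w : Fin (m + 1) → EuclideanSpace ℝ (Fin (m + 1))}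
    {u : Fin m → EuclideanSpace ℝ (Fin m)} (hw : ∀ j, w j.succ = consZero m (u j)) :
    ((EuclideanSpace.basisFun (Fin (m + 1)) ℝ).toBasis.unitsSMul (Fin.cons (-1) fun _ => 1)).det w =
      -(w 0 0 * (EuclideanSpace.basisFun (Fin m) ℝ).toBasis.det u) := by
  have h1 : ∀ i j, (EuclideanSpace.basisFun (Fin (m + 1)) ℝ).toBasis.toMatrix w i j = w j i :=
    fun _ _ => rfl
  have h2 : ∀ i j, (EuclideanSpace.basisFun (Fin m) ℝ).toBasis.toMatrix u i j = u j i :=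
    fun _ _ => rfl
  rw [Module.Basis.det_unitsSMul, Fin.prod_univ_succ]
  change (_ : ℝ) * (EuclideanSpace.basisFun (Fin (m + 1)) ℝ).toBasis.det w = _
  simp only [Fin.cons_zero, Fin.cons_succ, Finset.prod_const_one, mul_one, inv_neg, inv_one,
    Units.val_neg, Units.val_one, neg_one_mul]
  rw [Module.Basis.det_apply, Module.Basis.det_apply, Matrix.det_succ_row_zero,
    Fin.sum_univ_succ, Finset.sum_eq_zero, add_zero]
  · simp only [Fin.val_zero, pow_zero, one_mul, Fin.succAbove_zero, h1]
    congr 3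
    ext i j
    simp only [Matrix.submatrix_apply, h1, h2, hw, consZero_succ]
  · intro j _
    rw [h1, hw, consZero_zero, mul_zero, zero_mul]

theorem outwardBasis_det_coordBasis {y₀ y : (𝓡∂ (m + 1)).boundary Z}
    (hy : y.1 ∈ (chartAt (EuclideanHalfSpace (m + 1)) y₀.1).source)
    (hy' : y ∈ (chartAt (EuclideanSpace ℝ (Fin m)) y₀).source) :
    (outwardBasis y).det (coordBasis (𝓡∂ (m + 1)) hy) =
      -(tangentCoord (coordFrame (𝓡∂ (m + 1)) y₀.1 y.1 0) 0 *
        (boundaryBasis y).det (coordBasis (𝓡 m) hy')) := by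
  have h : boundaryDiff y = consZero m := mfderiv_boundary_val y
  rw [coe_coordBasis, coe_coordBasis]
  refine det_of_succ_eq_consZero (fun j => ?_)
  rw [← boundaryDiff_coordFrame hy, h]
  rfl

theorem isPosFrame_boundaryBasis_iff
    (o : (x : Z) → Orientation ℝ (TangentSpace (𝓡∂ (m + 1)) x) (Fin (m + 1)))
    (y : (𝓡∂ (m + 1)).boundary Z) :
    IsPosFrame (boundaryOrientation o y) (boundaryBasis y) ↔ IsPosFrame (o y.1) (outwardBasis y) := by
  rw [isPosFrame_basis_iff, coe_outwardBasis, boundaryOrientation]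
  split_ifs with h
  · simp [h]
  · simp only [h, iff_false]
    exact Module.Ray.ne_neg_self _

/-- The coordinate frame of the boundary is positive iff that of the manifold is negative: the
convention is outward vector first, and the first coordinate vector points inward. -/
theorem isPosFrame_boundary_coordFrame_iff
    (o : (x : Z) → Orientation ℝ (TangentSpace (𝓡∂ (m + 1)) x) (Fin (m + 1)))
    {y₀ y : (𝓡∂ (m + 1)).boundary Z}
    (hy : y.1 ∈ (chartAt (EuclideanHalfSpace (m + 1)) y₀.1).source) :
    IsPosFrame (boundaryOrientation o y) (coordFrame (𝓡 m) y₀ y) ↔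
      ¬ IsPosFrame (o y.1) (coordFrame (𝓡∂ (m + 1)) y₀.1 y.1) := by
  have hy' : y ∈ (chartAt (EuclideanSpace ℝ (Fin m)) y₀).source := hy
  have hdet := outwardBasis_det_coordBasis hy hy'
  have hne : (outwardBasis y).det (coordBasis (𝓡∂ (m + 1)) hy) ≠ 0 :=
    (Module.Basis.isUnit_det _ _).ne_zero
  -- The minimum argument gives only `0 ≤`; strictness holds because this component is a factor of a
  -- nonzero determinant.
  have hpos : 0 < tangentCoord (coordFrame (𝓡∂ (m + 1)) y₀.1 y.1 0) 0 := by
    refine lt_of_le_of_ne (coordFrame_zero_nonneg hy) fun h0 => hne ?_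
    rw [hdet, ← h0, zero_mul, neg_zero]
  have hD : (boundaryBasis y).det (coordBasis (𝓡 m) hy') ≠ 0 :=
    (Module.Basis.isUnit_det _ _).ne_zero
  rw [← coe_coordBasis hy', ← coe_coordBasis hy, isPosFrame_iff_of_det (boundaryBasis y),
    isPosFrame_iff_of_det (outwardBasis y), isPosFrame_boundaryBasis_iff, hdet, neg_pos,
    mul_neg_iff]
  simp only [hpos, hpos.not_gt, true_and, false_and, or_false]
  rcases lt_or_gt_of_ne hD with h | h
  · simp [h, h.not_gt]
  · simp [h, h.not_gt]

/-- The induced orientation of the boundary is continuous. -/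
def boundaryManifoldOrientation (o : ManifoldOrientation (𝓡∂ (m + 1)) Z) :
    ManifoldOrientation (𝓡 m) ((𝓡∂ (m + 1)).boundary Z) where
  toFun := boundaryOrientation o.toFun
  continuous' y₀ y hy := by
    have hsource : ∀ᶠ z : (𝓡∂ (m + 1)).boundary Z in 𝓝 y,
        z.1 ∈ (chartAt (EuclideanHalfSpace (m + 1)) y₀.1).source :=
      (chartAt (EuclideanSpace ℝ (Fin m)) y₀).open_source.mem_nhds hy
    rcases o.continuous' y₀.1 y.1 hy with h | h
    · right
      filter_upwards [hsource, continuous_subtype_val.continuousAt.eventually h] with z hz hz'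
      rw [isPosFrame_boundary_coordFrame_iff _ hz]
      exact not_not_intro hz'
    · left
      filter_upwards [hsource, continuous_subtype_val.continuousAt.eventually h] with z hz hz'
      rw [isPosFrame_boundary_coordFrame_iff _ hz]
      exact hz'

end BoundaryGeometry

/-! ### The Dirac structure and its orthogonal complement. -/

section DiracProof

variable {m p q : ℕ} {Z : Type*} [TopologicalSpace Z]
  [ChartedSpace (EuclideanHalfSpace (m + 1)) Z] [IsManifold (𝓡∂ (m + 1)) ∞ Z]
  (d : DegreePair m p q)
  (g : Bundle.ContMDiffRiemannianMetric (𝓡∂ (m + 1)) ∞ (EuclideanSpace ℝ (Fin (m + 1)))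
    (fun x : Z => TangentSpace (𝓡∂ (m + 1)) x))
  (o : ManifoldOrientation (𝓡∂ (m + 1)) Z)

/-- The Hodge star of `Z` on smooth forms. -/
def interiorStar {k l : ℕ} (h : k + l = m + 1) :
    Form (𝓡∂ (m + 1)) Z k →ₗ[ℝ] Form (𝓡∂ (m + 1)) Z l :=
  formStar (isSmoothMetric g) o h

/-- The Hodge star of `∂Z` on smooth forms. -/
def bdStar {k l : ℕ} (h : k + l = m) :
    Form (𝓡 m) ((𝓡∂ (m + 1)).boundary Z) k →ₗ[ℝ] Form (𝓡 m) ((𝓡∂ (m + 1)).boundary Z) l :=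
  formStar (isSmoothMetric_boundaryMetric (isSmoothMetric g)) (boundaryManifoldOrientation o) h

/-- The defect `⋆e + B e_u + 𝒜 f` in the first equation of the Dirac structure. -/
def flowDefect (A : Flow m p q Z →ₗ[ℝ] Flow m p q Z) (x : BondSpace m p q Z) : Flow m p q Z :=
  (interiorStar g o d.left x.2.2.1.1 + (A x.1).1,
    interiorStar g o d.right x.2.2.1.2.1 + (A x.1).2.1,
    bdStar g o d.bdLeft x.2.2.1.2.2.1 + x.2.2.2 + (A x.1).2.2.1,
    bdStar g o d.bdRight x.2.2.1.2.2.2 + (A x.1).2.2.2)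

/-- The defect `f_y - ⋆Bᵀ f` in the second equation of the Dirac structure. -/
def outputDefect (x : BondSpace m p q Z) : PortOutput m p Z :=
  x.2.1 - bdStar g o d.bdLeft' x.1.2.2.1

theorem Flow.toRaw_injective : Function.Injective (Flow.toRaw (m := m) (p := p) (q := q) (Z := Z)) :=
  Subtype.val_injective.prodMap (Subtype.val_injective.prodMap
    (Subtype.val_injective.prodMap Subtype.val_injective))

theorem toRaw_flowDefect (A : Flow m p q Z →ₗ[ℝ] Flow m p q Z) (x : BondSpace m p q Z) :
    (flowDefect d g o A x).toRaw =
      starEffort d g o x.2.2.1 + (portMap m p q Z x.2.2.2).toRaw + (A x.1).toRaw :=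
  -- In the components other than the third, `B e_u` contributes a zero that the defect omits.
  have hZ : ∀ {k : ℕ} (α β : RawForm (𝓡∂ (m + 1)) Z k), α + β = α + 0 + β :=
    fun α β => by rw [add_zero]
  have hB : ∀ {k : ℕ} (α β : RawForm (𝓡 m) ((𝓡∂ (m + 1)).boundary Z) k), α + β = α + 0 + β :=
    fun α β => by rw [add_zero]
  Prod.ext (hZ (interiorStar g o d.left x.2.2.1.1).1 (A x.1).1.1)
    (Prod.ext (hZ (interiorStar g o d.right x.2.2.1.2.1).1 (A x.1).2.1.1)
      (Prod.ext rfl (hB (bdStar g o d.bdRight x.2.2.1.2.2.2).1 (A x.1).2.2.2.1)))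

theorem mem_diracStructure_iff_defect {A : Flow m p q Z →ₗ[ℝ] Flow m p q Z}
    {x : BondSpace m p q Z} :
    x ∈ diracStructure d g o A ↔ flowDefect d g o A x = 0 ∧ outputDefect d g o x = 0 := by
  refine (mem_diracStructure_iff d g o).trans (and_congr ?_ ?_)
  · rw [neg_eq_iff_add_eq_zero, add_comm, ← toRaw_flowDefect,
      map_eq_zero_iff _ Flow.toRaw_injective]
  · rw [outputDefect, sub_eq_zero]
    exact (Subtype.ext_iff (a1 := x.2.1) (a2 := bdStar g o d.bdLeft' x.1.2.2.1)).symm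

/-- The components `f` and `e_u` are free parameters of `𝒟`: the second equation defines `f_y`, and
the first is solved for `e` because each `⋆` is onto. -/
theorem exists_mem_diracStructure (A : Flow m p q Z →ₗ[ℝ] Flow m p q Z) (f : Flow m p q Z)
    (eu : PortInput m p Z) :
    ∃ x ∈ diracStructure d g o A, x.1 = f ∧ x.2.2.2 = eu := by
  obtain ⟨e₁, h₁⟩ := formStar_surjective (isSmoothMetric g) o d.left (-(A f).1)
  obtain ⟨e₂, h₂⟩ := formStar_surjective (isSmoothMetric g) o d.right (-(A f).2.1)
  obtain ⟨e₃, h₃⟩ := formStar_surjective (isSmoothMetric_boundaryMetric (isSmoothMetric g))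
    (boundaryManifoldOrientation o) d.bdLeft (-((A f).2.2.1 + eu))
  obtain ⟨e₄, h₄⟩ := formStar_surjective (isSmoothMetric_boundaryMetric (isSmoothMetric g))
    (boundaryManifoldOrientation o) d.bdRight (-(A f).2.2.2)
  refine ⟨(f, bdStar g o d.bdLeft' f.2.2.1, (e₁, e₂, e₃, e₄), eu), ?_, rfl, rfl⟩
  rw [mem_diracStructure_iff_defect]
  refine ⟨?_, sub_self _⟩
  rw [eq_neg_iff_add_eq_zero] at h₁ h₂ h₃ h₄
  rw [add_comm (A f).2.2.1, ← add_assoc] at h₃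
  exact Prod.ext h₁ (Prod.ext h₂ (Prod.ext h₃ h₄))

variable [T2Space Z] [CompactSpace Z]

/-- The pairing `∫_Z α ∧ β` of smooth forms. -/
def interiorPairing {k l : ℕ} (h : k + l = m + 1) :
    Form (𝓡∂ (m + 1)) Z k →ₗ[ℝ] Form (𝓡∂ (m + 1)) Z l →ₗ[ℝ] ℝ :=
  wedgeIntegral o h

/-- The pairing `∫_∂Z α ∧ β` of smooth forms. -/
def bdPairing {k l : ℕ} (h : k + l = m) :
    Form (𝓡 m) ((𝓡∂ (m + 1)).boundary Z) k →ₗ[ℝ]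
      Form (𝓡 m) ((𝓡∂ (m + 1)).boundary Z) l →ₗ[ℝ] ℝ :=
  wedgeIntegral (boundaryManifoldOrientation o) h

/-- The pairing is defined on raw forms, where the integral need not be additive. Rewritten with the
bilinear pairings of smooth forms, its bilinearity is formal. -/
theorem noncanonicalPairing_eq (A : Flow m p q Z →ₗ[ℝ] Flow m p q Z) (x y : BondSpace m p q Z) :
    noncanonicalPairing d g o A x y =
      (interiorPairing o d.left x.2.2.1.1 y.1.1 + interiorPairing o d.right x.2.2.1.2.1 y.1.2.1 +
        bdPairing o d.bdLeft x.2.2.1.2.2.1 y.1.2.2.1 +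
        bdPairing o d.bdRight x.2.2.1.2.2.2 y.1.2.2.2) +
      (interiorPairing o d.left y.2.2.1.1 x.1.1 + interiorPairing o d.right y.2.2.1.2.1 x.1.2.1 +
        bdPairing o d.bdLeft y.2.2.1.2.2.1 x.1.2.2.1 +
        bdPairing o d.bdRight y.2.2.1.2.2.2 x.1.2.2.2) +
      ((interiorPairing o d.left' x.1.1 (interiorStar g o d.left' (A y.1).1) +
        interiorPairing o d.right' x.1.2.1 (interiorStar g o d.right' (A y.1).2.1) +
        bdPairing o d.bdLeft' x.1.2.2.1 (bdStar g o d.bdLeft' (A y.1).2.2.1) +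
        bdPairing o d.bdRight' x.1.2.2.2 (bdStar g o d.bdRight' (A y.1).2.2.2)) +
      (interiorPairing o d.left' y.1.1 (interiorStar g o d.left' (A x.1).1) +
        interiorPairing o d.right' y.1.2.1 (interiorStar g o d.right' (A x.1).2.1) +
        bdPairing o d.bdLeft' y.1.2.2.1 (bdStar g o d.bdLeft' (A x.1).2.2.1) +
        bdPairing o d.bdRight' y.1.2.2.2 (bdStar g o d.bdRight' (A x.1).2.2.2))) +
      bdPairing o d.bdLeft' x.2.2.2 y.2.1 + bdPairing o d.bdLeft' y.2.2.2 x.2.1 := by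
  obtain ⟨⟨f₁, f₂, f₃, f₄⟩, fy, ⟨e₁, e₂, e₃, e₄⟩, eu⟩ := x
  obtain ⟨⟨f₁', f₂', f₃', f₄'⟩, fy', ⟨e₁', e₂', e₃', e₄'⟩, eu'⟩ := y
  rfl

/-- The noncanonical pairing as a bilinear form. -/
def noncanonicalForm (A : Flow m p q Z →ₗ[ℝ] Flow m p q Z) :
    LinearMap.BilinForm ℝ (BondSpace m p q Z) :=
  LinearMap.mk₂ ℝ (noncanonicalPairing d g o A)
    (fun x x' y => by
      simp only [noncanonicalPairing_eq, Prod.fst_add, Prod.snd_add, map_add,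
        LinearMap.add_apply]
      ring)
    (fun c x y => by
      simp only [noncanonicalPairing_eq, Prod.smul_fst, Prod.smul_snd, map_smul,
        LinearMap.smul_apply, smul_eq_mul]
      ring)
    (fun x y y' => by
      simp only [noncanonicalPairing_eq, Prod.fst_add, Prod.snd_add, map_add,
        LinearMap.add_apply]
      ring)
    (fun c x y => by
      simp only [noncanonicalPairing_eq, Prod.smul_fst, Prod.smul_snd, map_smul,
        LinearMap.smul_apply, smul_eq_mul]
      ring)

theorem starPairing_eq (f f' : Flow m p q Z) :
    starPairing d g o f f' =
      interiorPairing o d.left' f.1 (interiorStar g o d.left' f'.1) +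
        interiorPairing o d.right' f.2.1 (interiorStar g o d.right' f'.2.1) +
        bdPairing o d.bdLeft' f.2.2.1 (bdStar g o d.bdLeft' f'.2.2.1) +
        bdPairing o d.bdRight' f.2.2.2 (bdStar g o d.bdRight' f'.2.2.2) := rfl

theorem starPairing_zero_right (f : Flow m p q Z) : starPairing d g o f 0 = 0 := by
  simp only [starPairing_eq, Prod.fst_zero, Prod.snd_zero, map_zero, add_zero]

theorem starPairing_zero_left (f : Flow m p q Z) : starPairing d g o 0 f = 0 := by
  simp only [starPairing_eq, Prod.fst_zero, Prod.snd_zero, map_zero, LinearMap.zero_apply,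
    add_zero]

/-- The pairing `∫ f ∧ ⋆f'` of flows is nondegenerate. -/
theorem eq_zero_of_forall_starPairing {f : Flow m p q Z}
    (hf : ∀ f', starPairing d g o f' f = 0) : f = 0 := by
  obtain ⟨f₁, f₂, f₃, f₄⟩ := f
  have hg := isSmoothMetric_boundaryMetric (isSmoothMetric g)
  -- Testing against each component of `f` separately isolates its squared `L²` norm.
  have h₁ := hf (f₁, 0, 0, 0)
  have h₂ := hf (0, f₂, 0, 0)
  have h₃ := hf (0, 0, f₃, 0)
  have h₄ := hf (0, 0, 0, f₄)
  simp only [starPairing_eq, map_zero, LinearMap.zero_apply, add_zero, zero_add] at h₁ h₂ h₃ h₄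
  exact Prod.ext (eq_zero_of_wedgeIntegral_formStar_self (isSmoothMetric g) o d.left' h₁)
    (Prod.ext (eq_zero_of_wedgeIntegral_formStar_self (isSmoothMetric g) o d.right' h₂)
    (Prod.ext (eq_zero_of_wedgeIntegral_formStar_self hg _ d.bdLeft' h₃)
      (eq_zero_of_wedgeIntegral_formStar_self hg _ d.bdRight' h₄)))

theorem interiorPairing_star_star {k l : ℕ} (h : k + l = m + 1) (h' : l + k = m + 1)
    (e : Form (𝓡∂ (m + 1)) Z k) (f : Form (𝓡∂ (m + 1)) Z l) :
    interiorPairing o h' f (interiorStar g o h' (interiorStar g o h e)) =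
      interiorPairing o h e f :=
  wedgeIntegral_formStar_formStar _ _ h h' e f

theorem bdPairing_star_star {k l : ℕ} (h : k + l = m) (h' : l + k = m)
    (e : Form (𝓡 m) ((𝓡∂ (m + 1)).boundary Z) k) (f : Form (𝓡 m) ((𝓡∂ (m + 1)).boundary Z) l) :
    bdPairing o h' f (bdStar g o h' (bdStar g o h e)) = bdPairing o h e f :=
  wedgeIntegral_formStar_formStar _ _ h h' e f

theorem bdPairing_star_comm {k l : ℕ} (h : k + l = m)
    (e f : Form (𝓡 m) ((𝓡∂ (m + 1)).boundary Z) k) :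
    bdPairing o h e (bdStar g o h f) = bdPairing o h f (bdStar g o h e) :=
  wedgeIntegral_formStar_comm _ _ h e f

/-- The pairing of flows with the defect in the first equation. -/
theorem starPairing_flowDefect (A : Flow m p q Z →ₗ[ℝ] Flow m p q Z) (f : Flow m p q Z)
    (x : BondSpace m p q Z) :
    starPairing d g o f (flowDefect d g o A x) =
      pairing d o x.2.2.1 f + starPairing d g o f (A x.1) +
        bdPairing o d.bdLeft' f.2.2.1 (bdStar g o d.bdLeft' x.2.2.2) := by
  have hp : pairing d o x.2.2.1 f = interiorPairing o d.left x.2.2.1.1 f.1 +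
      interiorPairing o d.right x.2.2.1.2.1 f.2.1 + bdPairing o d.bdLeft x.2.2.1.2.2.1 f.2.2.1 +
      bdPairing o d.bdRight x.2.2.1.2.2.2 f.2.2.2 := rfl
  rw [hp, starPairing_eq, starPairing_eq, flowDefect]
  simp only [map_add, interiorPairing_star_star, bdPairing_star_star]
  ring

theorem bdPairing_outputDefect (eu : PortInput m p Z) (x : BondSpace m p q Z) :
    bdPairing o d.bdLeft' eu (outputDefect d g o x) =
      bdPairing o d.bdLeft' eu x.2.1 -
        bdPairing o d.bdLeft' eu (bdStar g o d.bdLeft' x.1.2.2.1) :=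
  LinearMap.map_sub _ _ _

/-- The noncanonical pairing in terms of the defects in the equations of the Dirac structure. -/
theorem noncanonicalPairing_eq_defect (A : Flow m p q Z →ₗ[ℝ] Flow m p q Z)
    (x y : BondSpace m p q Z) :
    noncanonicalPairing d g o A x y =
      starPairing d g o x.1 (flowDefect d g o A y) + starPairing d g o y.1 (flowDefect d g o A x) +
      bdPairing o d.bdLeft' x.2.2.2 (outputDefect d g o y) +
      bdPairing o d.bdLeft' y.2.2.2 (outputDefect d g o x) := by
  have hn : noncanonicalPairing d g o A x y = pairing d o x.2.2.1 y.1 + pairing d o y.2.2.1 x.1 +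
      (starPairing d g o x.1 (A y.1) + starPairing d g o y.1 (A x.1)) +
      bdPairing o d.bdLeft' x.2.2.2 y.2.1 + bdPairing o d.bdLeft' y.2.2.2 x.2.1 := rfl
  rw [hn, starPairing_flowDefect d g o A x.1 y, starPairing_flowDefect d g o A y.1 x,
    bdPairing_outputDefect d g o x.2.2.2 y, bdPairing_outputDefect d g o y.2.2.2 x]
  -- What is left over are the port terms: `f₃ ∧ ⋆e_u` from the flow defect against `e_u ∧ ⋆f₃` from
  -- the output defect.
  linear_combination bdPairing_star_comm g o d.bdLeft' y.2.2.2 x.1.2.2.1 +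
    bdPairing_star_comm g o d.bdLeft' x.2.2.2 y.1.2.2.1

theorem diracStructure_eq_orthogonal (A : Flow m p q Z →ₗ[ℝ] Flow m p q Z) :
    diracStructure d g o A = (noncanonicalForm d g o A).orthogonal (diracStructure d g o A) := by
  ext y
  rw [LinearMap.BilinForm.mem_orthogonal_iff]
  have hform : ∀ x ∈ diracStructure d g o A, noncanonicalForm d g o A x y =
      starPairing d g o x.1 (flowDefect d g o A y) +
      bdPairing o d.bdLeft' x.2.2.2 (outputDefect d g o y) := fun x hx => by
    obtain ⟨h₁, h₂⟩ := (mem_diracStructure_iff_defect d g o).1 hx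
    refine (noncanonicalPairing_eq_defect d g o A x y).trans ?_
    rw [h₁, h₂, starPairing_zero_right, map_zero, add_zero, add_zero]
  constructor
  · intro hy x hx
    obtain ⟨h₁, h₂⟩ := (mem_diracStructure_iff_defect d g o).1 hy
    refine (hform x hx).trans ?_
    rw [h₁, h₂, starPairing_zero_right, map_zero, add_zero]
  · intro hy
    -- Since `f` and `e_u` are independent, setting either one to zero separates the two defects of
    -- `y`.
    have key : ∀ (f : Flow m p q Z) (eu : PortInput m p Z),
        starPairing d g o f (flowDefect d g o A y) +
          bdPairing o d.bdLeft' eu (outputDefect d g o y) = 0 := fun f eu => by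
      obtain ⟨x, hx, rfl, rfl⟩ := exists_mem_diracStructure d g o A f eu
      exact (hform x hx).symm.trans (hy x hx)
    rw [mem_diracStructure_iff_defect]
    refine ⟨eq_zero_of_forall_starPairing d g o fun f => ?_,
      eq_zero_of_forall_wedgeIntegral (boundaryManifoldOrientation o) d.bdLeft' (fun eu => ?_)
        (isSmoothMetric_boundaryMetric (isSmoothMetric g))⟩
    · simpa only [map_zero, LinearMap.zero_apply, add_zero] using key f 0
    · have h := key 0 eu
      rw [starPairing_zero_left, zero_add] at h
      exact h

end DiracProof

end NoncanDirac

end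

open NoncanDirac in
/-- On a compact oriented Riemannian manifold `Z` with boundary, of dimension `n = m + 1`, the
subspace `𝒟` equals its orthogonal complement for the noncanonical pairing, which is a bilinear
form. -/
theorem theorem1 {m p q : ℕ} (hp : 1 ≤ p) (hq : 1 ≤ q) (hpq : p + q = m + 2)
    {Z : Type*} [TopologicalSpace Z] [T2Space Z] [CompactSpace Z]
    [ChartedSpace (EuclideanHalfSpace (m + 1)) Z] [IsManifold (𝓡∂ (m + 1)) ∞ Z]
    (g : Bundle.ContMDiffRiemannianMetric (𝓡∂ (m + 1)) ∞ (EuclideanSpace ℝ (Fin (m + 1)))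
      (fun x : Z => TangentSpace (𝓡∂ (m + 1)) x))
    (o : ManifoldOrientation (𝓡∂ (m + 1)) Z)
    (A : Flow m p q Z →ₗ[ℝ] Flow m p q Z) :
    ∃ β : LinearMap.BilinForm ℝ (BondSpace m p q Z),
      (∀ x y, β x y = noncanonicalPairing ⟨hp, hq, hpq⟩ g o A x y) ∧
      diracStructure ⟨hp, hq, hpq⟩ g o A = β.orthogonal (diracStructure ⟨hp, hq, hpq⟩ g o A) := by
  exact ⟨noncanonicalForm ⟨hp, hq, hpq⟩ g o A, fun _ _ => rfl,
    diracStructure_eq_orthogonal ⟨hp, hq, hpq⟩ g o A⟩
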